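/- Let $N\ge 2$ be an integer, let $p$ be real with $p>1$ and $p^2<N$, and let $B=\{x\in\mathbb R^N:|x|<R\}$ with $0<R<\infty$. Put $p^*=Np/(N-p)$. Let $W_0^{1,p}(B)$ be the completion of $C_0^\infty(B)$ (smooth functions with compact support in $B$) in the norm $\|\nabla u\|_{L^p(B)}$, realised as a space of functions in $L^p(B)$ with weak gradient in $L^p(B)$, modulo equality almost everywhere. Let $$0<\mu\le \frac{N^{p-1}(N-p^2)}{p^p},\qquad 0<\lambda<\lambda_1(\mu):=\inf_{u\in W_0^{1,p}(B)\setminus\{0\}}\frac{\int_B\left(|\nabla u|^p-\mu|x|^{-p}|u|^p\right)dx}{\int_B|u|^p\,dx}.$$ Then the problem $$-\Delta_p u-\frac{\mu}{|x|^p}|u|^{p-2}u=|u|^{p^*-2}u+\lambda|u|^{p-2}u\ \text{ in }B,\qquad u=0\ \text{ on }\partial B,$$ where $\Delta_p u=\operatorname{div}(|\nabla u|^{p-2}\nabla u)$, has at most one positive radial weak solution. Here a weak solution is a $u\in W_0^{1,p}(B)$ such that for every $\varphi\in C_0^\infty(B)$ $$\int_B\left(|\nabla u|^{p-2}\nabla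 u\cdot\nabla\varphi-\frac{\mu}{|x|^p}|u|^{p-2}u\varphi-\lambda|u|^{p-2}u\varphi\right)dx=\int_B|u|^{p^*-2}u\varphi\,dx .$$ That is, if $u$ and $v$ are two weak solutions that are positive almost everywhere in $B$ and radial (almost everywhere equal to a function of $|x|$), then $u=v$ almost everywhere in $B$. -/

import Mathlib

open MeasureTheory Filter Topology
open scoped ContDiff

namespace HardySobolev

/-- `ℝᴺ` with the Euclidean norm. -/
abbrev Space (N : ℕ) : Type := EuclideanSpace ℝ (Fin N)

/-- `φ ∈ C₀^∞(Ω)`: smooth, with compact support contained in `Ω`. -/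
def IsTestFunction {N : ℕ} (Ω : Set (Space N)) (φ : Space N → ℝ) : Prop :=
  ContDiff ℝ ∞ φ ∧ HasCompactSupport φ ∧ tsupport φ ⊆ Ω

/-- `u ∈ W₀^{1,p}(Ω)` with weak gradient `G = ∇u`, for a bounded open set `Ω`: the pair `(u, G)` is
the limit in `L^p(Ω)` of pairs `(φₙ, ∇φₙ)` with `φₙ ∈ C₀^∞(Ω)`. Since `Ω` is bounded, Poincaré's
inequality makes this the completion of `C₀^∞(Ω)` in the norm `‖∇φ‖_{L^p(Ω)}`. Functions are
considered up to equality almost everywhere in `Ω`; their values outside `Ω` play no role. -/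
def MemW01p {N : ℕ} (p : ℝ) (Ω : Set (Space N)) (u : Space N → ℝ) (G : Space N → Space N) :
    Prop :=
  MemLp u (ENNReal.ofReal p) (volume.restrict Ω) ∧
  MemLp G (ENNReal.ofReal p) (volume.restrict Ω) ∧
  ∃ φ : ℕ → Space N → ℝ, (∀ n, IsTestFunction Ω (φ n)) ∧
    Tendsto (fun n => eLpNorm (fun x => φ n x - u x) (ENNReal.ofReal p) (volume.restrict Ω))
      atTop (𝓝 0) ∧
    Tendsto (fun n => eLpNorm (fun x => gradient (φ n) x - G x) (ENNReal.ofReal p)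
      (volume.restrict Ω)) atTop (𝓝 0)

/-- The critical Sobolev exponent `p* = N p / (N - p)`. -/
noncomputable def critExp (N : ℕ) (p : ℝ) : ℝ := N * p / (N - p)

/-- The first eigenvalue `λ₁(μ)`: the infimum over `u ∈ W₀^{1,p}(Ω) \ {0}` of
`∫_Ω (|∇u|^p - μ |x|^{-p} |u|^p) dx / ∫_Ω |u|^p dx`. -/
noncomputable def firstEigenvalue {N : ℕ} (p μ : ℝ) (Ω : Set (Space N)) : ℝ :=
  sInf {q : ℝ | ∃ (u : Space N → ℝ) (G : Space N → Space N), MemW01p p Ω u G ∧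
    ¬ (∀ᵐ x ∂(volume.restrict Ω), u x = 0) ∧
    q = (∫ x in Ω, (‖G x‖ ^ p - μ * ‖x‖ ^ (-p) * |u x| ^ p)) / ∫ x in Ω, |u x| ^ p}

/-- `u ∈ W₀^{1,p}(Ω)` is a weak solution of
`-Δ_p u - μ |x|^{-p} |u|^{p-2} u = |u|^{p*-2} u + lam |u|^{p-2} u` in `Ω`, `u = 0` on `∂Ω`. -/
def IsWeakSolution {N : ℕ} (p μ lam : ℝ) (Ω : Set (Space N)) (u : Space N → ℝ) : Prop :=
  ∃ G : Space N → Space N, MemW01p p Ω u G ∧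
    ∀ φ : Space N → ℝ, IsTestFunction Ω φ →
      ∫ x in Ω, (‖G x‖ ^ (p - 2) * inner ℝ (G x) (gradient φ x)
          - μ / ‖x‖ ^ p * (|u x| ^ (p - 2) * u x) * φ x
          - lam * (|u x| ^ (p - 2) * u x) * φ x)
        = ∫ x in Ω, |u x| ^ (critExp N p - 2) * u x * φ x

/-- `u` is positive in `Ω` (almost everywhere, as `u` is an `L^p` class). -/
def IsPositive {N : ℕ} (Ω : Set (Space N)) (u : Space N → ℝ) : Prop :=
  ∀ᵐ x ∂(volume.restrict Ω), 0 < u x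

/-- `u` is radial in `Ω`: almost everywhere in `Ω`, `u x` is a function of `|x|`. -/
def IsRadial {N : ℕ} (Ω : Set (Space N)) (u : Space N → ℝ) : Prop :=
  ∃ f : ℝ → ℝ, ∀ᵐ x ∂(volume.restrict Ω), u x = f ‖x‖

end HardySobolev

/-! A radial solution with profile `f` and flux `q = -r^(n-1) |f'|^(p-2) f'` is studied through the
scale-adapted variables y = (-r f'/f)^(p-1) and H = r^(n-p) f^p. They satisfy r y' = F(y) + lam r^p
+ H^σ and r H' = -F'(y) H, with σ = p/(n-p) and the strictly convex function F(y) = (p-1)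
y^(p/(p-1)) - (n-p) y + μ. For lam = 0 the Pohozaev energy E = H (F(y) + lam r^p + H^σ/(1+σ)) is
conserved; in general E' = p lam r^(p-1) H > 0, and E > 0 because E vanishes at the origin.

Given two solutions, put X = (H₂/H₁) E₁ - E₂. The lam-terms cancel in X', which is a positive
multiple of F'(y₁) - F'(y₂) and so has the sign of y₁ - y₂. Where y₁ = y₂, both X and (y₁ - y₂)'
have the sign of H₁ - H₂. Since X vanishes at 0, a crossing with H₁ ≠ H₂ is impossible
(`IsRiccatiSolution.H_le_of_eq`, used in both orders). If the y's never cross, X is strictly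
monotone, yet it vanishes at both ends. Hence the solutions meet at some point in both variables
(`IsRiccatiSolution.exists_eq`) and coincide by ODE uniqueness (`IsRiccatiSolution.eqOn`).

The endpoint limits rest on the following facts. Near 0, y is bounded above and below by positive
constants, so finiteness of the integral of |∇u|^p forces H → 0
(`IsPositiveProfile.tendsto_profileH`). At R the flux is positive, E tends to (p-1) R^n |f'(R)|^p,
and l'Hôpital gives H₂/H₁ → |f₂'(R)/f₁'(R)|^p, so X → 0.

The remaining work is regularity. Spherical averaging and the Du Bois-Reymond lemma turn a radial
Sobolev function into a primitive vanishing at R; the same lemma applied to the weak equation makes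
the flux differentiable (`IsWeakSolution.exists_profile`). Monotonicity of the flux then gives f > 0
and q > 0 on the whole interval. -/

namespace HardySobolev

/-! ### Comparison of two solutions of the abstract Riccati system. -/

section Riccati

open Set

/-- A positive solution `(y, H)` of `r y' = F(y) + lam r ^ p + H ^ σ`, `r H' = -F'(y) H`
on `(0, R)`; here `F₁` stands for `F'`. -/
structure IsRiccatiSolution (F F₁ : ℝ → ℝ) (p lam σ R : ℝ) (y H : ℝ → ℝ) : Prop where
  y_pos : ∀ r ∈ Ioo 0 R, 0 < y r
  H_pos : ∀ r ∈ Ioo 0 R, 0 < H r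
  deriv_y : ∀ r ∈ Ioo 0 R, HasDerivAt y ((F (y r) + lam * r ^ p + H r ^ σ) / r) r
  deriv_H : ∀ r ∈ Ioo 0 R, HasDerivAt H (-(F₁ (y r) * H r) / r) r

/-- The Pohozaev energy of a solution of the Riccati system. -/
noncomputable def pohozaevEnergy (F : ℝ → ℝ) (p lam σ : ℝ) (y H : ℝ → ℝ) (r : ℝ) : ℝ :=
  H r * (F (y r) + lam * r ^ p + (1 + σ)⁻¹ * H r ^ σ)

variable {F F₁ : ℝ → ℝ} {p lam σ R : ℝ} {y H y₁ H₁ y₂ H₂ : ℝ → ℝ}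

/-- All terms containing F' cancel, the weight 1/(1+σ) being chosen for this; only the explicit
dependence on r survives. -/
theorem IsRiccatiSolution.hasDerivAt_energy (hF : ∀ x, 0 < x → HasDerivAt F (F₁ x) x)
    (hσ : 0 < σ) (h : IsRiccatiSolution F F₁ p lam σ R y H) {r : ℝ} (hr : r ∈ Ioo 0 R) :
    HasDerivAt (pohozaevEnergy F p lam σ y H) (p * lam * r ^ (p - 1) * H r) r := by
  have hr0 : 0 < r := hr.1
  have hH := h.H_pos r hr
  have h1 := (hF _ (h.y_pos r hr)).comp r (h.deriv_y r hr)
  have h2 : HasDerivAt (fun r : ℝ => lam * r ^ p) (lam * (p * r ^ (p - 1))) r :=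
    (Real.hasDerivAt_rpow_const (Or.inl hr0.ne')).const_mul lam
  have h3 := ((h.deriv_H r hr).rpow_const (p := σ) (Or.inl hH.ne')).const_mul (1 + σ)⁻¹
  have h4 := (h.deriv_H r hr).mul ((h1.add h2).add h3)
  refine h4.congr_deriv ?_
  have e1 : H r ^ (σ - 1) = H r ^ σ / H r := by rw [Real.rpow_sub_one hH.ne']
  have e2 : r ^ (p - 1) = r ^ p / r := by rw [Real.rpow_sub_one hr0.ne']
  simp only [Pi.add_apply, Function.comp_apply, e1, e2]
  have : 1 + σ ≠ 0 := by positivity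
  field_simp
  ring

theorem strictMonoOn_Ioo_of_hasDerivAt_pos {g g' : ℝ → ℝ} {a b : ℝ}
    (h : ∀ r ∈ Ioo a b, HasDerivAt g (g' r) r) (h' : ∀ r ∈ Ioo a b, 0 < g' r) :
    StrictMonoOn g (Ioo a b) :=
  strictMonoOn_of_hasDerivWithinAt_pos (convex_Ioo a b)
    (fun r hr => (h r hr).continuousAt.continuousWithinAt)
    (fun r hr => (h r (interior_subset hr)).hasDerivWithinAt)
    (fun r hr => h' r (interior_subset hr))

theorem _root_.StrictMonoOn.pos_of_tendsto_zero {g : ℝ → ℝ} {b : ℝ}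
    (hg : StrictMonoOn g (Ioo 0 b)) (h0 : Tendsto g (𝓝[>] 0) (𝓝 0)) {r : ℝ} (hr : r ∈ Ioo 0 b) :
    0 < g r := by
  have hr2 : r / 2 ∈ Ioo 0 b := ⟨by linarith [hr.1], by linarith [hr.1, hr.2]⟩
  have h1 : 0 ≤ g (r / 2) := by
    refine le_of_tendsto h0 ?_
    filter_upwards [Ioo_mem_nhdsGT hr2.1] with s hs
    exact (hg ⟨hs.1, hs.2.trans hr2.2⟩ hr2 hs.2).le
  exact h1.trans_lt (hg hr2 hr (by linarith [hr.1]))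

theorem _root_.StrictMonoOn.neg_of_tendsto_zero {g : ℝ → ℝ} {b : ℝ}
    (hg : StrictMonoOn g (Ioo 0 b)) (h0 : Tendsto g (𝓝[<] b) (𝓝 0)) {r : ℝ} (hr : r ∈ Ioo 0 b) :
    g r < 0 := by
  have hr2 : (r + b) / 2 ∈ Ioo 0 b := ⟨by linarith [hr.1, hr.2], by linarith [hr.1, hr.2]⟩
  have h1 : g ((r + b) / 2) ≤ 0 := by
    refine ge_of_tendsto h0 ?_
    filter_upwards [Ioo_mem_nhdsLT hr2.2] with s hs
    exact (hg hr2 ⟨hr2.1.trans hs.1, hs.2⟩ hs.1).le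
  exact (hg hr hr2 (by linarith [hr.2])).trans_le h1

/-- The comparison of the energies of two solutions. -/
noncomputable def energyDefect (F : ℝ → ℝ) (p lam σ : ℝ) (y₁ H₁ y₂ H₂ : ℝ → ℝ) (r : ℝ) : ℝ :=
  H₂ r / H₁ r * pohozaevEnergy F p lam σ y₁ H₁ r - pohozaevEnergy F p lam σ y₂ H₂ r

/-- Both energies grow at a rate proportional to their own H with the same factor, so the weight
H₂/H₁ makes these rates cancel and only the logarithmic derivative of H₂/H₁ contributes. -/
theorem hasDerivAt_energyDefect (hF : ∀ x, 0 < x → HasDerivAt F (F₁ x) x) (hσ : 0 < σ)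
    (h₁ : IsRiccatiSolution F F₁ p lam σ R y₁ H₁) (h₂ : IsRiccatiSolution F F₁ p lam σ R y₂ H₂)
    {r : ℝ} (hr : r ∈ Ioo 0 R) :
    HasDerivAt (energyDefect F p lam σ y₁ H₁ y₂ H₂)
      (H₂ r / H₁ r * (F₁ (y₁ r) - F₁ (y₂ r)) / r * pohozaevEnergy F p lam σ y₁ H₁ r) r := by
  have hr0 : 0 < r := hr.1
  have hH := h₁.H_pos r hr
  have := (((h₂.deriv_H r hr).div (h₁.deriv_H r hr) hH.ne').mul
    (h₁.hasDerivAt_energy hF hσ hr)).sub (h₂.hasDerivAt_energy hF hσ hr)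
  refine this.congr_deriv ?_
  simp only [Pi.div_apply]
  field_simp
  ring

/-- At a crossing the F and lam terms cancel, so the sign of the defect compares H₁ with H₂; the
slope of y₁ - y₂ there has the same sign. -/
theorem energyDefect_of_eq (h₁ : IsRiccatiSolution F F₁ p lam σ R y₁ H₁)
    {r : ℝ} (hr : r ∈ Ioo 0 R) (hy : y₁ r = y₂ r) :
    energyDefect F p lam σ y₁ H₁ y₂ H₂ r = (1 + σ)⁻¹ * H₂ r * (H₁ r ^ σ - H₂ r ^ σ) := by
  have hH := h₁.H_pos r hr
  simp only [energyDefect, pohozaevEnergy, hy]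
  field_simp
  ring

theorem IsRiccatiSolution.energy_pos (hF : ∀ x, 0 < x → HasDerivAt F (F₁ x) x)
    (hσ : 0 < σ) (hp : 0 < p) (hlam : 0 < lam) (h : IsRiccatiSolution F F₁ p lam σ R y H)
    (h0 : Tendsto (pohozaevEnergy F p lam σ y H) (𝓝[>] 0) (𝓝 0)) {r : ℝ} (hr : r ∈ Ioo 0 R) :
    0 < pohozaevEnergy F p lam σ y H r := by
  refine (strictMonoOn_Ioo_of_hasDerivAt_pos (fun s hs => h.hasDerivAt_energy hF hσ hs)
    fun s hs => ?_).pos_of_tendsto_zero h0 hr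
  have := h.H_pos s hs
  have := hs.1
  positivity

/-- Where the `y`-components of two solutions cross, the `H`-component of the first one is not
larger. -/
theorem IsRiccatiSolution.H_le_of_eq (hF : ∀ x, 0 < x → HasDerivAt F (F₁ x) x)
    (hF₁ : StrictMonoOn F₁ (Ioi 0)) (hσ : 0 < σ) (hp : 0 < p) (hlam : 0 < lam)
    (h₁ : IsRiccatiSolution F F₁ p lam σ R y₁ H₁) (h₂ : IsRiccatiSolution F F₁ p lam σ R y₂ H₂)
    (hE₁ : Tendsto (pohozaevEnergy F p lam σ y₁ H₁) (𝓝[>] 0) (𝓝 0))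
    (hX : Tendsto (energyDefect F p lam σ y₁ H₁ y₂ H₂) (𝓝[>] 0) (𝓝 0))
    {t : ℝ} (ht : t ∈ Ioo 0 R) (hy : y₁ t = y₂ t) : H₁ t ≤ H₂ t := by
  by_contra! hlt
  set X := energyDefect F p lam σ y₁ H₁ y₂ H₂ with hXdef
  have hsub : ∀ {s}, s ∈ Ioo 0 t → s ∈ Ioo 0 R := fun hs => ⟨hs.1, hs.2.trans ht.2⟩
  have hd : ∀ s ∈ Ioo 0 R, y₁ s = y₂ s → HasDerivAt (fun r => y₁ r - y₂ r)
      ((H₁ s ^ σ - H₂ s ^ σ) / s) s := fun s hs hys => by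
    refine ((h₁.deriv_y s hs).sub (h₂.deriv_y s hs)).congr_deriv ?_
    rw [hys]; ring
  have hdpos : ∀ s ∈ Ioo 0 R, H₂ s < H₁ s → 0 < (H₁ s ^ σ - H₂ s ^ σ) / s := fun s hs hs' =>
    div_pos (sub_pos.2 (Real.rpow_lt_rpow (h₂.H_pos s hs).le hs' hσ)) hs.1
  have hXt : 0 < X t := by
    rw [hXdef, energyDefect_of_eq h₁ ht hy]
    have := Real.rpow_lt_rpow (h₂.H_pos t ht).le hlt hσ
    have := h₂.H_pos t ht
    have : 0 < H₁ t ^ σ - H₂ t ^ σ := by linarith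
    positivity
  have hXderiv : ∀ s ∈ Ioo 0 R, y₁ s < y₂ s →
      H₂ s / H₁ s * (F₁ (y₁ s) - F₁ (y₂ s)) / s * pohozaevEnergy F p lam σ y₁ H₁ s < 0 := by
    intro s hs hlt
    have e := h₁.energy_pos hF hσ hp hlam hE₁ hs
    have h1 := h₁.H_pos s hs
    have h2 := h₂.H_pos s hs
    have h3 := hF₁ (h₁.y_pos s hs) (h₂.y_pos s hs) hlt
    have h4 := hs.1
    have h5 : 0 < H₂ s / H₁ s / s * pohozaevEnergy F p lam σ y₁ H₁ s := by positivity
    calc _ = (F₁ (y₁ s) - F₁ (y₂ s)) *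
          (H₂ s / H₁ s / s * pohozaevEnergy F p lam σ y₁ H₁ s) := by ring
      _ < 0 := mul_neg_of_neg_of_pos (by linarith) h5
  have hXcont : ∀ s ∈ Ioo 0 R, ContinuousAt X s := fun s hs =>
    (hasDerivAt_energyDefect hF hσ h₁ h₂ hs).continuousAt
  -- left of `t` the difference is negative
  have hleft : ∀ᶠ s in 𝓝[<] t, y₁ s < y₂ s := by
    have := (hd t ht hy).hasDerivWithinAt (s := Iio t)
    have := (hasDerivWithinAt_iff_tendsto_slope' (by simp)).1 this
    filter_upwards [this.eventually_const_lt (hdpos t ht hlt), self_mem_nhdsWithin] with s hs hs'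
    rw [slope_def_field, hy, sub_self, sub_zero] at hs
    have : s - t < 0 := sub_neg.2 hs'
    rcases div_pos_iff.1 hs with h | h <;> linarith [h.1, h.2]
  obtain ⟨b, hb, hbt⟩ := (mem_nhdsLT_iff_exists_Ioo_subset' ht.1).1 hleft
  set S := {s | s ∈ Ioo 0 t ∧ y₂ s ≤ y₁ s} with hS
  have hanti : ∀ a, 0 ≤ a → (∀ s ∈ Ioo a t, y₁ s < y₂ s) → StrictAntiOn X (Ioc a t) := by
    intro a ha hs
    refine strictAntiOn_of_hasDerivWithinAt_neg (convex_Ioc a t)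
      (fun r hr => (hXcont r ⟨ha.trans_lt hr.1, hr.2.trans_lt ht.2⟩).continuousWithinAt)
      (f' := fun s => H₂ s / H₁ s * (F₁ (y₁ s) - F₁ (y₂ s)) / s *
        pohozaevEnergy F p lam σ y₁ H₁ s) ?_ ?_
    · intro r hr
      rw [interior_Ioc] at hr
      exact (hasDerivAt_energyDefect hF hσ h₁ h₂
        ⟨ha.trans_lt hr.1, hr.2.trans ht.2⟩).hasDerivWithinAt
    · intro r hr
      rw [interior_Ioc] at hr
      exact hXderiv r ⟨ha.trans_lt hr.1, hr.2.trans ht.2⟩ (hs r hr)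
  -- Without an earlier point where y₂ ≤ y₁, the defect decreases on all of (0, t] from the limit 0,
  -- contradicting its positivity at t. Otherwise the last such point is examined.
  rcases S.eq_empty_or_nonempty with hSe | hSne
  · have hA := hanti 0 le_rfl fun s hs => by
      by_contra! hc
      exact (hSe ▸ (show s ∈ S from ⟨hs, hc⟩) : s ∈ (∅ : Set ℝ))
    have : X t ≤ 0 := by
      refine ge_of_tendsto hX ?_
      filter_upwards [Ioo_mem_nhdsGT ht.1] with s hs
      exact (hA ⟨hs.1, hs.2.le⟩ ⟨ht.1, le_rfl⟩ hs.2).le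
    linarith
  · have hSb : ∀ s ∈ S, s ≤ b := fun s hs => by
      by_contra! hc
      exact absurd (hbt ⟨hc, hs.1.2⟩) (not_lt.2 hs.2)
    set a := sSup S
    have haS : ∀ s ∈ S, s ≤ a := fun s hs => le_csSup ⟨b, hSb⟩ hs
    obtain ⟨s₀, hs₀⟩ := hSne
    have ha0 : 0 < a := hs₀.1.1.trans_le (haS s₀ hs₀)
    have hat : a < t := (csSup_le ⟨s₀, hs₀⟩ hSb).trans_lt hb
    have haR : a ∈ Ioo 0 R := ⟨ha0, hat.trans ht.2⟩
    have hneg : ∀ s ∈ Ioo a t, y₁ s < y₂ s := fun s hs => by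
      by_contra! hc
      exact absurd (haS s ⟨⟨ha0.trans hs.1, hs.2⟩, hc⟩) (not_le.2 hs.1)
    have hdc : ContinuousAt (fun r => y₁ r - y₂ r) a :=
      (h₁.deriv_y a haR).continuousAt.sub (h₂.deriv_y a haR).continuousAt
    have hge : 0 ≤ y₁ a - y₂ a := by
      have hcl : a ∈ closure S := csSup_mem_closure ⟨s₀, hs₀⟩ ⟨b, hSb⟩
      have : (fun r => y₁ r - y₂ r) a ∈ closure ((fun r => y₁ r - y₂ r) '' S) :=
        mem_closure_image hdc hcl
      refine (closure_minimal ?_ isClosed_Ici this : _ ∈ Ici (0 : ℝ))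
      rintro _ ⟨s, hs, rfl⟩
      exact sub_nonneg.2 hs.2
    have hle : y₁ a - y₂ a ≤ 0 := by
      refine le_of_tendsto (hdc.tendsto.mono_left nhdsWithin_le_nhds : Tendsto _ (𝓝[>] a) _) ?_
      filter_upwards [Ioo_mem_nhdsGT hat] with s hs
      exact sub_nonpos.2 (hneg s hs).le
    have hya : y₁ a = y₂ a := by linarith
    have hXa : X t ≤ X a := by
      refine ge_of_tendsto ((hXcont a haR).tendsto.mono_left nhdsWithin_le_nhds :
        Tendsto _ (𝓝[>] a) _) ?_
      filter_upwards [Ioo_mem_nhdsGT hat] with s hs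
      exact (hanti a ha0.le hneg ⟨hs.1, hs.2.le⟩ ⟨hat, le_rfl⟩ hs.2).le
    -- The defect at a is at least its positive value at t, so y₁ crosses y₂ upwards at a, although
    -- y₁ < y₂ immediately to the right of a.
    have hHa : H₂ a < H₁ a := by
      by_contra! hc
      rw [hXdef, energyDefect_of_eq h₁ haR hya] at hXa
      have h1 := Real.rpow_le_rpow (h₁.H_pos a haR).le hc hσ.le
      have h2 := h₂.H_pos a haR
      have : (1 + σ)⁻¹ * H₂ a * (H₁ a ^ σ - H₂ a ^ σ) ≤ 0 :=
        mul_nonpos_of_nonneg_of_nonpos (by positivity) (by linarith)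
      linarith
    have hright : ∀ᶠ s in 𝓝[>] a, y₂ s < y₁ s := by
      have := (hd a haR hya).hasDerivWithinAt (s := Ioi a)
      have := (hasDerivWithinAt_iff_tendsto_slope' (by simp)).1 this
      filter_upwards [this.eventually_const_lt (hdpos a haR hHa), self_mem_nhdsWithin]
        with s hs hs'
      rw [slope_def_field, hya, sub_self, sub_zero] at hs
      have : 0 < s - a := sub_pos.2 hs'
      have := (div_pos_iff_of_pos_right this).1 hs
      linarith
    obtain ⟨s, hs, hs'⟩ := (hright.and (Ioo_mem_nhdsGT hat)).exists
    exact absurd hs (not_lt.2 (hneg s hs').le)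

/-- Two solutions of the Riccati system whose energy defects vanish at both ends meet. -/
theorem IsRiccatiSolution.exists_eq (hF : ∀ x, 0 < x → HasDerivAt F (F₁ x) x)
    (hF₁ : StrictMonoOn F₁ (Ioi 0)) (hσ : 0 < σ) (hp : 0 < p) (hlam : 0 < lam) (hR : 0 < R)
    (h₁ : IsRiccatiSolution F F₁ p lam σ R y₁ H₁) (h₂ : IsRiccatiSolution F F₁ p lam σ R y₂ H₂)
    (hE₁ : Tendsto (pohozaevEnergy F p lam σ y₁ H₁) (𝓝[>] 0) (𝓝 0))
    (hE₂ : Tendsto (pohozaevEnergy F p lam σ y₂ H₂) (𝓝[>] 0) (𝓝 0))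
    (hX : Tendsto (energyDefect F p lam σ y₁ H₁ y₂ H₂) (𝓝[>] 0) (𝓝 0))
    (hX' : Tendsto (energyDefect F p lam σ y₂ H₂ y₁ H₁) (𝓝[>] 0) (𝓝 0))
    (hXR : Tendsto (energyDefect F p lam σ y₁ H₁ y₂ H₂) (𝓝[<] R) (𝓝 0)) :
    ∃ t ∈ Ioo 0 R, y₁ t = y₂ t ∧ H₁ t = H₂ t := by
  by_cases hz : ∃ t ∈ Ioo 0 R, y₁ t = y₂ t
  · obtain ⟨t, ht, hy⟩ := hz
    exact ⟨t, ht, hy, le_antisymm (h₁.H_le_of_eq hF hF₁ hσ hp hlam h₂ hE₁ hX ht hy)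
      (h₂.H_le_of_eq hF hF₁ hσ hp hlam h₁ hE₂ hX' ht hy.symm)⟩
  exfalso
  push Not at hz
  have hmid : R / 2 ∈ Ioo 0 R := ⟨by linarith, by linarith⟩
  have hcont : ContinuousOn (fun r => y₁ r - y₂ r) (Ioo 0 R) := fun s hs =>
    ((h₁.deriv_y s hs).continuousAt.sub (h₂.deriv_y s hs).continuousAt).continuousWithinAt
  have hsign : (∀ s ∈ Ioo 0 R, y₂ s < y₁ s) ∨ ∀ s ∈ Ioo 0 R, y₁ s < y₂ s := by
    by_contra! hc
    obtain ⟨⟨s, hs, hs'⟩, r, hr, hr'⟩ := hc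
    obtain ⟨c, hc, hc0⟩ := isPreconnected_Ioo.intermediate_value hs hr hcont
      ⟨sub_nonpos.2 hs', sub_nonneg.2 hr'⟩
    exact hz c hc (sub_eq_zero.1 hc0)
  have hpos : ∀ s ∈ Ioo 0 R, 0 < H₂ s / H₁ s / s * pohozaevEnergy F p lam σ y₁ H₁ s := by
    intro s hs
    have e := h₁.energy_pos hF hσ hp hlam hE₁ hs
    have h1 := h₁.H_pos s hs
    have h2 := h₂.H_pos s hs
    have h4 := hs.1
    positivity
  -- With y₁ - y₂ of constant sign the defect is strictly monotone, which is incompatible with zero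
  -- limits at both ends.
  rcases hsign with hs | hs
  · have hm := strictMonoOn_Ioo_of_hasDerivAt_pos
      (fun r hr => hasDerivAt_energyDefect hF hσ h₁ h₂ hr) (fun r hr => by
        have := mul_pos (hpos r hr)
          (sub_pos.2 (hF₁ (h₂.y_pos r hr) (h₁.y_pos r hr) (hs r hr)))
        exact this.trans_eq (by ring))
    exact lt_asymm (hm.pos_of_tendsto_zero hX hmid) (hm.neg_of_tendsto_zero hXR hmid)
  · have hm := strictMonoOn_Ioo_of_hasDerivAt_pos
      (fun r hr => (hasDerivAt_energyDefect hF hσ h₁ h₂ hr).neg) (fun r hr => by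
        have := mul_pos (hpos r hr)
          (sub_pos.2 (hF₁ (h₁.y_pos r hr) (h₂.y_pos r hr) (hs r hr)))
        exact this.trans_eq (by ring))
    exact lt_asymm (hm.pos_of_tendsto_zero (by have := hX.neg; rwa [neg_zero] at this) hmid)
      (hm.neg_of_tendsto_zero (by have := hXR.neg; rwa [neg_zero] at this) hmid)

end Riccati


/-! ### From radial profiles to the Riccati system. -/

section Profile

open Set

/-- The nonlinearity of the Riccati equation of the Hardy–Sobolev problem. -/
noncomputable def riccatiF (n p μ y : ℝ) : ℝ := (p - 1) * (y * y ^ (1 / (p - 1))) - (n - p) * y + μ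

/-- The derivative of `riccatiF`. -/
noncomputable def riccatiF₁ (n p y : ℝ) : ℝ := p * y ^ (1 / (p - 1)) - (n - p)

theorem hasDerivAt_riccatiF {n p μ y : ℝ} (hp : 1 < p) (hy : 0 < y) :
    HasDerivAt (riccatiF n p μ) (riccatiF₁ n p y) y := by
  have hp' : p - 1 ≠ 0 := by linarith
  have h1 : HasDerivAt (fun y : ℝ => y ^ (1 / (p - 1))) _ y :=
    Real.hasDerivAt_rpow_const (Or.inl hy.ne')
  have h2 := ((((hasDerivAt_id y).mul h1).const_mul (p - 1)).sub
    ((hasDerivAt_id y).const_mul (n - p))).add_const μ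
  refine h2.congr_deriv ?_
  simp only [id, riccatiF₁, Real.rpow_sub_one hy.ne']
  field_simp
  ring

/-- This is the strict convexity of `riccatiF`, on which the sign of the derivative of the energy
defect depends. -/
theorem strictMonoOn_riccatiF₁ {n p : ℝ} (hp : 1 < p) : StrictMonoOn (riccatiF₁ n p) (Ioi 0) := by
  intro a ha b hb hab
  have hp' : 0 < 1 / (p - 1) := by have : 0 < p - 1 := by linarith
                                   positivity
  have := Real.rpow_lt_rpow (le_of_lt ha) hab hp'
  have : p * a ^ (1 / (p - 1)) < p * b ^ (1 / (p - 1)) := by gcongr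
  simp only [riccatiF₁]
  linarith

/-- Positive solutions of the Riccati system are determined by their value at one point. -/
theorem IsRiccatiSolution.eqOn {n p μ lam σ R : ℝ} {y₁ H₁ y₂ H₂ : ℝ → ℝ}
    (h₁ : IsRiccatiSolution (riccatiF n p μ) (riccatiF₁ n p) p lam σ R y₁ H₁)
    (h₂ : IsRiccatiSolution (riccatiF n p μ) (riccatiF₁ n p) p lam σ R y₂ H₂)
    {t : ℝ} (ht : t ∈ Ioo 0 R) (hy : y₁ t = y₂ t) (hH : H₁ t = H₂ t) :
    EqOn H₁ H₂ (Ioo 0 R) := by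
  intro r hr
  obtain ⟨a, ha0, ha⟩ : ∃ a, 0 < a ∧ a < min r t :=
    ⟨min r t / 2, by have := lt_min hr.1 ht.1; linarith, by have := lt_min hr.1 ht.1; linarith⟩
  obtain ⟨b, hb, hbR⟩ : ∃ b, max r t < b ∧ b < R := exists_between (max_lt hr.2 ht.2)
  have hsub : Icc a b ⊆ Ioo 0 R := fun s hs => ⟨ha0.trans_le hs.1, hs.2.trans_lt hbR⟩
  set U : Set (ℝ × ℝ) := Ioi 0 ×ˢ Ioi 0
  have hUo : IsOpen U := isOpen_Ioi.prod isOpen_Ioi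
  -- The autonomous part of r (y, H)'. It is smooth only on the open quadrant, since its real powers
  -- may be singular on the axes.
  set W : ℝ × ℝ → ℝ × ℝ := fun x => (riccatiF n p μ x.1 + x.2 ^ σ, -(riccatiF₁ n p x.1 * x.2))
  have hW : LocallyLipschitzOn U W := by
    intro x hx
    have h1 : x.1 ≠ 0 := (show 0 < x.1 from hx.1).ne'
    have h2 : x.2 ≠ 0 := (show 0 < x.2 from hx.2).ne'
    have : ContDiffAt ℝ 1 W x := by
      simp only [W, riccatiF, riccatiF₁]
      have e1 : ContDiffAt ℝ 1 (fun x : ℝ × ℝ => x.1 ^ (1 / (p - 1))) x :=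
        contDiffAt_fst.rpow_const_of_ne h1
      have e2 : ContDiffAt ℝ 1 (fun x : ℝ × ℝ => x.2 ^ σ) x :=
        contDiffAt_snd.rpow_const_of_ne h2
      fun_prop
    obtain ⟨K, s, hs, hl⟩ := this.exists_lipschitzOnWith
    exact ⟨K, s, mem_nhdsWithin_of_mem_nhds hs, hl⟩
  have hmem₁ : ∀ s ∈ Icc a b, (y₁ s, H₁ s) ∈ U := fun s hs =>
    ⟨h₁.y_pos s (hsub hs), h₁.H_pos s (hsub hs)⟩
  have hmem₂ : ∀ s ∈ Icc a b, (y₂ s, H₂ s) ∈ U := fun s hs =>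
    ⟨h₂.y_pos s (hsub hs), h₂.H_pos s (hsub hs)⟩
  -- Both trajectories over [a, b] form a compact subset of the quadrant, where the local Lipschitz
  -- bound becomes uniform.
  set C : Set (ℝ × ℝ) := (fun s => (y₁ s, H₁ s)) '' Icc a b ∪ (fun s => (y₂ s, H₂ s)) '' Icc a b
  have hC : IsCompact C := by
    refine (isCompact_Icc.image_of_continuousOn ?_).union (isCompact_Icc.image_of_continuousOn ?_)
    · exact fun s hs => ((h₁.deriv_y s (hsub hs)).continuousAt.prodMk
        (h₁.deriv_H s (hsub hs)).continuousAt).continuousWithinAt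
    · exact fun s hs => ((h₂.deriv_y s (hsub hs)).continuousAt.prodMk
        (h₂.deriv_H s (hsub hs)).continuousAt).continuousWithinAt
  have hCU : C ⊆ U := by
    rintro _ (⟨s, hs, rfl⟩ | ⟨s, hs, rfl⟩)
    exacts [hmem₁ s hs, hmem₂ s hs]
  obtain ⟨K, hK⟩ := (hW.mono hCU).exists_lipschitzOnWith_of_compact hC
  set v : ℝ → ℝ × ℝ → ℝ × ℝ := fun s x => s⁻¹ • (W x + (lam * s ^ p, 0))
  have hv : ∀ s ∈ Ioo a b, LipschitzOnWith (‖a⁻¹‖₊ * K) (v s) C := by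
    intro s hs
    refine LipschitzOnWith.of_dist_le_mul fun x hx z hz => ?_
    have h1 := hK.dist_le_mul x hx z hz
    have h2 : dist (v s x) (v s z) = s⁻¹ * dist (W x) (W z) := by
      simp only [v, dist_smul₀, dist_add_right, Real.norm_eq_abs]
      rw [abs_of_pos (inv_pos.2 (ha0.trans hs.1))]
    have h3 : s⁻¹ ≤ a⁻¹ := inv_anti₀ ha0 hs.1.le
    have h4 : ((‖a⁻¹‖₊ * K : NNReal) : ℝ) = a⁻¹ * K := by
      simp [abs_of_pos ha0]
    rw [h2, h4, mul_assoc]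
    exact mul_le_mul h3 h1 dist_nonneg (inv_pos.2 ha0).le
  have hsol : ∀ {y H : ℝ → ℝ}, IsRiccatiSolution (riccatiF n p μ) (riccatiF₁ n p) p lam σ R y H →
      ∀ s ∈ Ioo a b, HasDerivAt (fun s => (y s, H s)) (v s (y s, H s)) s := by
    intro y H h s hs
    have hs' := hsub (Ioo_subset_Icc_self hs)
    refine ((h.deriv_y s hs').prodMk (h.deriv_H s hs')).congr_deriv ?_
    simp only [v, W, Prod.mk_add_mk, Prod.smul_mk, smul_eq_mul, Prod.mk.injEq]
    constructor <;> ring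
  have := ODE_solution_unique_of_mem_Ioo (s := fun _ => C) hv
    (t₀ := t) ⟨ha.trans_le (min_le_right _ _), (le_max_right _ _).trans_lt hb⟩
    (fun s hs => ⟨hsol h₁ s hs, Or.inl ⟨s, Ioo_subset_Icc_self hs, rfl⟩⟩)
    (fun s hs => ⟨hsol h₂ s hs, Or.inr ⟨s, Ioo_subset_Icc_self hs, rfl⟩⟩)
    (by rw [hy, hH])
  have := this ⟨ha.trans_le (min_le_left _ _), (le_max_left _ _).trans_lt hb⟩
  exact congrArg Prod.snd this

/-- `f` is the profile of a positive radial solution in the ball of radius `R`, and `q` is its flux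
`-r ^ (n - 1) |f'| ^ (p - 2) f'`. -/
structure IsPositiveProfile (n p μ lam R : ℝ) (f q : ℝ → ℝ) : Prop where
  f_pos : ∀ r ∈ Ioo 0 R, 0 < f r
  q_pos : ∀ r ∈ Ioo 0 R, 0 < q r
  deriv_f : ∀ r ∈ Ioo 0 R, HasDerivAt f (-(q r * r ^ (1 - n)) ^ (1 / (p - 1))) r
  deriv_q : ∀ r ∈ Ioo 0 R, HasDerivAt q
    (r ^ (n - 1) * (f r ^ (p - 1) * (μ * r ^ (-p) + lam + f r ^ (p * (p / (n - p)))))) r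
  f_R : Tendsto f (𝓝[<] R) (𝓝 0)
  q_R : Tendsto q (𝓝[<] R) (𝓝 (q R))
  energy : IntegrableOn (fun r => r ^ (n - 1) * ((q r * r ^ (1 - n)) ^ (1 / (p - 1))) ^ p)
    (Ioo 0 R)

variable {n p μ lam R : ℝ} {f q : ℝ → ℝ}

/-- The first Riccati variable `(-r f' / f) ^ (p - 1)`. -/
noncomputable def profileY (n p : ℝ) (f q : ℝ → ℝ) (r : ℝ) : ℝ :=
  q r * r ^ (1 - n) * (r / f r) ^ (p - 1)

/-- The second Riccati variable `r ^ (n - p) f ^ p`. -/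
noncomputable def profileH (n p : ℝ) (f : ℝ → ℝ) (r : ℝ) : ℝ := r ^ (n - p) * f r ^ p

theorem IsPositiveProfile.profileY_pos (h : IsPositiveProfile n p μ lam R f q) {r : ℝ}
    (hr : r ∈ Ioo 0 R) : 0 < profileY n p f q r := by
  have := h.f_pos r hr
  have := h.q_pos r hr
  have := hr.1
  unfold profileY
  positivity

theorem IsPositiveProfile.profileH_pos (h : IsPositiveProfile n p μ lam R f q) {r : ℝ}
    (hr : r ∈ Ioo 0 R) : 0 < profileH n p f r := by
  have := h.f_pos r hr
  have := hr.1
  unfold profileH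
  positivity

theorem IsPositiveProfile.profileY_rpow (hp : 1 < p) (h : IsPositiveProfile n p μ lam R f q)
    {r : ℝ} (hr : r ∈ Ioo 0 R) :
    profileY n p f q r ^ (1 / (p - 1)) = (q r * r ^ (1 - n)) ^ (1 / (p - 1)) * (r / f r) := by
  have h1 := h.f_pos r hr
  have h2 := h.q_pos r hr
  have h3 := hr.1
  have hp' : p - 1 ≠ 0 := by linarith
  rw [profileY, Real.mul_rpow (by positivity) (by positivity), ← Real.rpow_mul (by positivity),
    mul_one_div_cancel hp', Real.rpow_one]

/-- The powers of r cancel. The product stays controlled at r = R, where `profileY` alone contains a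
negative power of the vanishing f. -/
theorem IsPositiveProfile.profileH_mul_profileY (h : IsPositiveProfile n p μ lam R f q)
    {r : ℝ} (hr : r ∈ Ioo 0 R) : profileH n p f r * profileY n p f q r = q r * f r := by
  have h1 := h.f_pos r hr
  have h3 := hr.1
  rw [profileY, profileH, Real.div_rpow h3.le h1.le]
  have e1 : f r ^ (p - 1) = f r ^ p / f r := Real.rpow_sub_one h1.ne' _
  have e2 : r ^ (n - p) * r ^ (1 - n) * r ^ (p - 1) = 1 := by
    rw [← Real.rpow_add h3, ← Real.rpow_add h3]; ring_nf; simp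
  have : f r ^ p ≠ 0 := by positivity
  rw [e1]
  field_simp
  calc _ = q r * (r ^ (n - p) * r ^ (1 - n) * r ^ (p - 1)) := by ring
    _ = _ := by rw [e2, mul_one]

/-- The choice σ = p/(n-p) turns the critical nonlinearity into a function of H alone: after
multiplication by r^p, the factor f^(p* - p) becomes H^σ. -/
theorem profileH_rpow (hpn : p < n) {r : ℝ} (hr : 0 ≤ r) (hf : 0 ≤ f r) :
    profileH n p f r ^ (p / (n - p)) = r ^ p * f r ^ (p * (p / (n - p))) := by
  have : n - p ≠ 0 := by linarith
  rw [profileH, Real.mul_rpow (by positivity) (by positivity), ← Real.rpow_mul hr,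
    ← Real.rpow_mul hf, mul_div_cancel₀ _ this]

theorem IsPositiveProfile.isRiccatiSolution (hp : 1 < p) (hpn : p < n)
    (h : IsPositiveProfile n p μ lam R f q) :
    IsRiccatiSolution (riccatiF n p μ) (riccatiF₁ n p) p lam (p / (n - p)) R
      (profileY n p f q) (profileH n p f) where
  y_pos r hr := h.profileY_pos hr
  H_pos r hr := h.profileH_pos hr
  deriv_y r hr := by
    have h1 := h.f_pos r hr
    have h2 := h.q_pos r hr
    have h3 := hr.1
    have hrf : 0 < r / f r := by positivity
    have hd := ((h.deriv_q r hr).mul (Real.hasDerivAt_rpow_const (x := r) (p := 1 - n)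
      (Or.inl h3.ne'))).mul ((((hasDerivAt_id r).div (h.deriv_f r hr) h1.ne')).rpow_const
        (p := p - 1) (Or.inl hrf.ne'))
    refine hd.congr_deriv ?_
    simp only [Pi.mul_apply, Pi.div_apply, id, riccatiF, h.profileY_rpow hp hr,
      profileH_rpow hpn h3.le h1.le]
    set s := (q r * r ^ (1 - n)) ^ (1 / (p - 1))
    have e1 : (r / f r) ^ (p - 1 - 1) = (r / f r) ^ (p - 1) / (r / f r) :=
      Real.rpow_sub_one hrf.ne' _
    have e2 : r ^ (1 - n - 1) = r ^ (1 - n) / r := Real.rpow_sub_one h3.ne' _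
    have e3 : r ^ (n - 1) * r ^ (1 - n) = 1 := by
      rw [← Real.rpow_add h3]; simp
    have e4 : (r / f r) ^ (p - 1) = r ^ p / r / f r ^ (p - 1) := by
      rw [Real.div_rpow h3.le h1.le, Real.rpow_sub_one h3.ne' p]
    have e5 : r ^ (-p) = 1 / r ^ p := by rw [Real.rpow_neg h3.le, one_div]
    have hY : profileY n p f q r = q r * r ^ (1 - n) * (r / f r) ^ (p - 1) := rfl
    rw [e1, e2]
    set B := f r ^ (p * (p / (n - p)))
    have key : r ^ (n - 1) * (f r ^ (p - 1) * (μ * r ^ (-p) + lam + B)) * r ^ (1 - n) *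
        (r / f r) ^ (p - 1) = (μ + lam * r ^ p + r ^ p * B) / r := by
      have a1 : 0 < f r ^ (p - 1) := by positivity
      have a2 : 0 < r ^ p := by positivity
      calc _ = (r ^ (n - 1) * r ^ (1 - n)) * (f r ^ (p - 1) * (μ * r ^ (-p) + lam + B) *
            (r / f r) ^ (p - 1)) := by ring
        _ = _ := by
          rw [e3, e4, e5]
          field_simp
    rw [add_mul, key, hY]
    field_simp
    ring
  deriv_H r hr := by
    have h1 := h.f_pos r hr
    have h3 := hr.1
    have hd := (Real.hasDerivAt_rpow_const (x := r) (p := n - p) (Or.inl h3.ne')).mul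
      ((h.deriv_f r hr).rpow_const (p := p) (Or.inl h1.ne'))
    refine hd.congr_deriv ?_
    simp only [riccatiF₁, h.profileY_rpow hp hr, profileH]
    have e1 : f r ^ (p - 1) = f r ^ p / f r := Real.rpow_sub_one h1.ne' _
    have e2 : r ^ (n - p - 1) = r ^ (n - p) / r := Real.rpow_sub_one h3.ne' _
    rw [e1, e2]
    field_simp
    ring

end Profile


/-! ### Asymptotics at the origin and at the boundary, and uniqueness of the profile. -/

section Endpoints

open Set

variable {n p μ lam R : ℝ} {f q f₁ q₁ f₂ q₂ : ℝ → ℝ}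

/-- The integrating factor r^(n-p) absorbs the linear term of the Riccati equation. The remaining
terms are positive after subtracting μ/(n-p), so the weighted difference increases; y > 0 bounds it
below by a quantity tending to 0 at the origin. -/
theorem IsPositiveProfile.le_profileY (hp : 1 < p) (hpn : p < n) (hlam : 0 < lam)
    (h : IsPositiveProfile n p μ lam R f q) {r : ℝ} (hr : r ∈ Ioo 0 R) :
    μ / (n - p) ≤ profileY n p f q r := by
  have hs := h.isRiccatiSolution hp hpn
  have hnp : 0 < n - p := by linarith
  set g : ℝ → ℝ := fun r => r ^ (n - p) * (profileY n p f q r - μ / (n - p))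
  have hm : StrictMonoOn g (Ioo 0 R) := by
    refine strictMonoOn_Ioo_of_hasDerivAt_pos (fun s hs' =>
      (Real.hasDerivAt_rpow_const (x := s) (p := n - p) (Or.inl hs'.1.ne')).mul
        ((hs.deriv_y s hs').sub_const (μ / (n - p)))) fun s hs' => ?_
    have h1 := hs'.1
    have h2 := hs.y_pos s hs'
    have h3 := hs.H_pos s hs'
    have hp' : 0 < p - 1 := by linarith
    rw [Real.rpow_sub_one h1.ne', riccatiF]
    have : 0 < s ^ (n - p) / s * ((p - 1) * (profileY n p f q s * profileY n p f q s ^ (1 / (p - 1)))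
      + lam * s ^ p + profileH n p f s ^ (p / (n - p))) := by positivity
    refine this.trans_eq ?_
    field_simp
    ring
  have h0 : Tendsto (fun r : ℝ => -(r ^ (n - p) * (μ / (n - p)))) (𝓝[>] 0) (𝓝 0) := by
    have : Tendsto (fun r : ℝ => r ^ (n - p)) (𝓝[>] 0) (𝓝 (0 ^ (n - p))) :=
      (Real.continuousAt_rpow_const 0 _ (Or.inr hnp.le)).tendsto.mono_left nhdsWithin_le_nhds
    rw [Real.zero_rpow hnp.ne'] at this
    simpa using (this.mul_const (μ / (n - p))).neg
  have hg : 0 ≤ g r := by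
    refine le_of_tendsto h0 ?_
    filter_upwards [Ioo_mem_nhdsGT hr.1] with s hs'
    have hsR : s ∈ Ioo 0 R := ⟨hs'.1, hs'.2.trans hr.2⟩
    refine le_trans ?_ (hm hsR hr hs'.2).le
    have : 0 < s ^ (n - p) * profileY n p f q s :=
      mul_pos (Real.rpow_pos_of_pos hs'.1 _) (hs.y_pos s hsR)
    simp only [g]
    linarith
  by_contra! hc
  have : g r < 0 := mul_neg_of_pos_of_neg (Real.rpow_pos_of_pos hr.1 _) (by linarith)
  linarith

/-- Once y exceeds ((n-p)/(p-1))^(p-1), the superlinear term dominates the negative one and y' > 0.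
A maximum over [r, t] above this threshold can therefore occur only at t. -/
theorem IsPositiveProfile.profileY_le (hp : 1 < p) (hpn : p < n) (hlam : 0 < lam) (hμ : 0 < μ)
    (h : IsPositiveProfile n p μ lam R f q) {t : ℝ} (ht : t ∈ Ioo 0 R) :
    ∃ M, 0 ≤ M ∧ ∀ r ∈ Ioc 0 t, profileY n p f q r ≤ M := by
  have hs := h.isRiccatiSolution hp hpn
  have hp' : 0 < p - 1 := by linarith
  have hnp : 0 < n - p := by linarith
  set M := max (((n - p) / (p - 1)) ^ (p - 1)) (profileY n p f q t) with hM
  refine ⟨M, le_max_of_le_left (by positivity), fun r hr => ?_⟩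
  by_contra! hc
  have hsub : Icc r t ⊆ Ioo 0 R := fun s hs => ⟨hr.1.trans_le hs.1, hs.2.trans_lt ht.2⟩
  obtain ⟨s, hst, hmax⟩ := isCompact_Icc.exists_isMaxOn (nonempty_Icc.2 hr.2)
    (f := profileY n p f q)
    (fun s hs' => (hs.deriv_y s (hsub hs')).continuousAt.continuousWithinAt)
  have hsM : M < profileY n p f q s := hc.trans_le (hmax ⟨le_rfl, hr.2⟩)
  have hs' := hsub hst
  have hne : s ≠ t := by
    rintro rfl
    exact absurd hsM (not_lt.2 (le_max_right _ _))
  have hlt : s < t := lt_of_le_of_ne hst.2 hne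
  have hpos : 0 < (riccatiF n p μ (profileY n p f q s) + lam * s ^ p +
      profileH n p f s ^ (p / (n - p))) / s := by
    have h1 := hs'.1
    have h2 := hs.y_pos s hs'
    have h3 := hs.H_pos s hs'
    have h4 : (n - p) / (p - 1) ≤ profileY n p f q s ^ (1 / (p - 1)) := by
      have := Real.rpow_le_rpow (by positivity) ((le_max_left _ _).trans hsM.le)
        (one_div_pos.2 hp').le
      rwa [← Real.rpow_mul (by positivity), mul_one_div_cancel hp'.ne', Real.rpow_one] at this
    rw [div_le_iff₀ hp'] at h4
    have h5 : 0 < riccatiF n p μ (profileY n p f q s) := by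
      have := mul_le_mul_of_nonneg_right h4 h2.le
      simp only [riccatiF]
      linarith
    positivity
  have hright : ∀ᶠ x in 𝓝[>] s, profileY n p f q s < profileY n p f q x := by
    have := (hs.deriv_y s hs').hasDerivWithinAt (s := Ioi s)
    have := (hasDerivWithinAt_iff_tendsto_slope' (by simp)).1 this
    filter_upwards [this.eventually_const_lt hpos, self_mem_nhdsWithin] with x hx hx'
    rw [slope_def_field] at hx
    have : 0 < x - s := sub_pos.2 hx'
    have := (div_pos_iff_of_pos_right this).1 hx
    linarith
  obtain ⟨x, hx, hx'⟩ := (hright.and (Ioo_mem_nhdsGT hlt)).exists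
  exact absurd hx (not_lt.2 (hmax ⟨hst.1.trans hx'.1.le, hx'.2.le⟩))

/-- The energy density r^(n-1) |f'|^p equals (H/r) y^(p/(p-1)), hence is at least c H/r by the lower
bound on y. Since f decreases, H on (r/2, r] is comparable from below to H(r), so H(r) is bounded by
a multiple of the energy in (0, r]. -/
theorem IsPositiveProfile.tendsto_profileH (hp : 1 < p) (hpn : p < n) (hlam : 0 < lam) (hμ : 0 < μ)
    (hR : 0 < R) (h : IsPositiveProfile n p μ lam R f q) :
    Tendsto (profileH n p f) (𝓝[>] 0) (𝓝 0) := by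
  have hs := h.isRiccatiSolution hp hpn
  have hp' : 0 < p - 1 := by linarith
  have hnp : 0 < n - p := by linarith
  set g : ℝ → ℝ := fun r => r ^ (n - 1) * ((q r * r ^ (1 - n)) ^ (1 / (p - 1))) ^ p with hg
  set c := μ / (n - p) * (μ / (n - p)) ^ (1 / (p - 1)) with hc
  have hc0 : 0 < c := by positivity
  have hgH : ∀ r ∈ Ioo 0 R, c * (profileH n p f r / r) ≤ g r := by
    intro r hr
    have h1 := h.f_pos r hr
    have h2 := h.q_pos r hr
    have h3 := hr.1
    have h4 := h.le_profileY hp hpn hlam hr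
    have h5 := hs.H_pos r hr
    have h6 := hs.y_pos r hr
    have e1 : g r = profileH n p f r / r *
        (profileY n p f q r * profileY n p f q r ^ (1 / (p - 1))) := by
      rw [h.profileY_rpow hp hr]
      have e2 := h.profileH_mul_profileY hr
      have e3 : ((q r * r ^ (1 - n)) ^ (1 / (p - 1))) ^ (p - 1) = q r * r ^ (1 - n) := by
        rw [← Real.rpow_mul (by positivity), one_div_mul_cancel hp'.ne', Real.rpow_one]
      have e4 : r ^ (n - 1) * r ^ (1 - n) = 1 := by rw [← Real.rpow_add h3]; simp
      simp only [hg]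
      have hs0 : 0 < (q r * r ^ (1 - n)) ^ (1 / (p - 1)) := by positivity
      have e5 : ((q r * r ^ (1 - n)) ^ (1 / (p - 1))) ^ p =
          ((q r * r ^ (1 - n)) ^ (1 / (p - 1))) ^ (p - 1) * (q r * r ^ (1 - n)) ^ (1 / (p - 1)) := by
        rw [← Real.rpow_add_one hs0.ne']; simp
      rw [e5, e3]
      calc _ = r ^ (n - 1) * r ^ (1 - n) * q r * (q r * r ^ (1 - n)) ^ (1 / (p - 1)) := by ring
        _ = (profileH n p f r * profileY n p f q r) / f r *
            (q r * r ^ (1 - n)) ^ (1 / (p - 1)) := by rw [e2, e4]; field_simp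
        _ = _ := by field_simp
    rw [e1, mul_comm c]
    have : c ≤ profileY n p f q r * profileY n p f q r ^ (1 / (p - 1)) := by
      rw [hc]
      gcongr
    gcongr
  -- The quantity r^(-(n-p)) H is f^p, so this is the monotonicity of f in the variables of the
  -- system.
  have hanti : StrictMonoOn (fun r => -(r ^ (-(n - p)) * profileH n p f r)) (Ioo 0 R) := by
    refine strictMonoOn_Ioo_of_hasDerivAt_pos (fun s hs' =>
      ((Real.hasDerivAt_rpow_const (x := s) (p := -(n - p)) (Or.inl hs'.1.ne')).mul
        (hs.deriv_H s hs')).neg) fun s hs' => ?_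
    have h1 := hs'.1
    have h2 := hs.y_pos s hs'
    have h3 := hs.H_pos s hs'
    rw [Real.rpow_sub_one h1.ne', riccatiF₁]
    have : 0 < s ^ (-(n - p)) / s * (p * profileY n p f q s ^ (1 / (p - 1)) * profileH n p f s) := by
      positivity
    refine this.trans_eq ?_
    ring
  have hint : Tendsto (fun r => ∫ s in Ioc 0 r, g s) (𝓝[>] 0) (𝓝 0) := by
    have hI : IntegrableOn g (Icc 0 (R / 2)) := by
      rw [integrableOn_Icc_iff_integrableOn_Ioc]
      exact h.energy.mono_set fun x hx => ⟨hx.1, by linarith [hx.2]⟩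
    have := (intervalIntegral.continuousOn_primitive hI) 0 ⟨le_rfl, by linarith⟩
    have := (this.mono Ioc_subset_Icc_self).tendsto
    simp only [Ioc_self, Measure.restrict_empty, integral_zero_measure] at this
    rwa [nhdsWithin_Ioc_eq_nhdsGT (by linarith)] at this
  have hbound : ∀ r ∈ Ioo 0 R, profileH n p f r ≤
      -- The factor (1/2)^(n-p) compares H on (r/2, r] with H(r); the final 1/2 comes from the
      -- length r/2 of that interval.
      (c * (1 / 2) ^ (n - p) / 2)⁻¹ * ∫ s in Ioc 0 r, g s := by
    intro r hr
    have h3 := hr.1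
    have hHr := hs.H_pos r hr
    have hgi : IntegrableOn g (Ioc 0 r) := h.energy.mono_set fun x hx => ⟨hx.1, hx.2.trans_lt hr.2⟩
    have hsub : Ioc (r / 2) r ⊆ Ioc 0 r := Ioc_subset_Ioc_left (by linarith)
    have hg0 : ∀ s ∈ Ioc 0 r, 0 ≤ g s := fun s hs' => by
      have hsR : s ∈ Ioo 0 R := ⟨hs'.1, hs'.2.trans_lt hr.2⟩
      have h5 := hs.H_pos s hsR
      have := hs'.1
      exact le_trans (by positivity) (hgH s hsR)
    have hge : ∀ s ∈ Ioc (r / 2) r, c * ((1 / 2) ^ (n - p) * profileH n p f r / r) ≤ g s := by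
      intro s hs'
      have hs0 := hsub hs'
      have hsR : s ∈ Ioo 0 R := ⟨hs0.1, hs0.2.trans_lt hr.2⟩
      have h5 := hs.H_pos s hsR
      refine le_trans ?_ (hgH s hsR)
      have h6 := hanti.monotoneOn hsR hr hs'.2
      simp only [neg_le_neg_iff] at h6
      have h7 : (1 / 2) ^ (n - p) * profileH n p f r ≤ profileH n p f s := by
        have h8 := hs0.1
        have e : profileH n p f s = s ^ (n - p) * (s ^ (-(n - p)) * profileH n p f s) := by
          rw [← mul_assoc, ← Real.rpow_add h8]; simp
        rw [e]
        calc _ = (r / 2) ^ (n - p) * (r ^ (-(n - p)) * profileH n p f r) := by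
              rw [Real.rpow_neg h3.le, Real.div_rpow h3.le (by norm_num),
                Real.div_rpow (by norm_num) (by norm_num), Real.one_rpow]
              field_simp
          _ ≤ s ^ (n - p) * (r ^ (-(n - p)) * profileH n p f r) := by
              gcongr
              exact hs'.1.le
          _ ≤ _ := by gcongr
      have := hs0.1
      have := hs0.2
      gcongr
    have h8 : (r / 2) * (c * ((1 / 2) ^ (n - p) * profileH n p f r / r)) ≤
        ∫ s in Ioc (r / 2) r, g s := by
      have := setIntegral_mono_on (integrableOn_const (by simp)) (hgi.mono_set hsub)
        measurableSet_Ioc hge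
      rw [setIntegral_const] at this
      simp only [Real.volume_real_Ioc, smul_eq_mul] at this
      rwa [max_eq_left (by linarith), show r - r / 2 = r / 2 by ring] at this
    have h9 : ∫ s in Ioc (r / 2) r, g s ≤ ∫ s in Ioc 0 r, g s :=
      setIntegral_mono_set hgi ((ae_restrict_iff' measurableSet_Ioc).2 (ae_of_all _ hg0))
        (LE.le.eventuallyLE hsub)
    rw [inv_mul_eq_div, le_div_iff₀ (by positivity)]
    refine le_trans (le_of_eq ?_) (h8.trans h9)
    field_simp
  refine tendsto_of_tendsto_of_tendsto_of_le_of_le' tendsto_const_nhds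
    (by have := hint.const_mul (c * (1 / 2) ^ (n - p) / 2)⁻¹; rwa [mul_zero] at this) ?_ ?_
  · filter_upwards [Ioo_mem_nhdsGT hR] with r hr using (hs.H_pos r hr).le
  · filter_upwards [Ioo_mem_nhdsGT hR] with r hr using hbound r hr

/-- The energy density per unit of `profileH`. -/
noncomputable def energyRatio (n p μ lam : ℝ) (f q : ℝ → ℝ) (r : ℝ) : ℝ :=
  riccatiF n p μ (profileY n p f q r) + lam * r ^ p +
    (1 + p / (n - p))⁻¹ * profileH n p f r ^ (p / (n - p))

theorem IsPositiveProfile.isBoundedUnder_energyRatio (hp : 1 < p) (hpn : p < n) (hlam : 0 < lam)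
    (hμ : 0 < μ) (hR : 0 < R) (h : IsPositiveProfile n p μ lam R f q) :
    IsBoundedUnder (· ≤ ·) (𝓝[>] 0) (norm ∘ energyRatio n p μ lam f q) := by
  have hs := h.isRiccatiSolution hp hpn
  have hp' : 0 < p - 1 := by linarith
  have hnp : 0 < n - p := by linarith
  have hmid : R / 2 ∈ Ioo 0 R := ⟨by linarith, by linarith⟩
  obtain ⟨M, hM0, hM⟩ := h.profileY_le hp hpn hlam hμ hmid
  refine ⟨(p - 1) * (M * M ^ (1 / (p - 1))) + (n - p) * M + μ + lam * R ^ p +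
    (1 + p / (n - p))⁻¹ * 1 ^ (p / (n - p)), ?_⟩
  rw [eventually_map]
  filter_upwards [Ioo_mem_nhdsGT hmid.1, (h.tendsto_profileH hp hpn hlam hμ hR).eventually_le_const
    zero_lt_one] with r hr hr1
  have hrR : r ∈ Ioo 0 R := ⟨hr.1, hr.2.trans hmid.2⟩
  have h1 := hs.y_pos r hrR
  have h2 := hs.H_pos r hrR
  have h3 := hM r ⟨hr.1, hr.2.le⟩
  have h4 := hr.1
  have a1 : (p - 1) * (profileY n p f q r * profileY n p f q r ^ (1 / (p - 1))) ≤
    (p - 1) * (M * M ^ (1 / (p - 1))) := by gcongr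
  have a2 : (n - p) * profileY n p f q r ≤ (n - p) * M := by gcongr
  have a3 : lam * r ^ p ≤ lam * R ^ p := by gcongr; exact hrR.2.le
  have a4 : (1 + p / (n - p))⁻¹ * profileH n p f r ^ (p / (n - p)) ≤
    (1 + p / (n - p))⁻¹ * 1 ^ (p / (n - p)) := by gcongr
  have b1 : 0 ≤ (p - 1) * (profileY n p f q r * profileY n p f q r ^ (1 / (p - 1))) := by positivity
  have b2 : 0 ≤ (n - p) * profileY n p f q r := by positivity
  have b3 : 0 ≤ lam * r ^ p := by positivity
  have b4 : 0 ≤ (1 + p / (n - p))⁻¹ * profileH n p f r ^ (p / (n - p)) := by positivity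
  simp only [Function.comp_apply, energyRatio, riccatiF, Real.norm_eq_abs]
  rw [abs_le]
  constructor <;> linarith

theorem IsPositiveProfile.tendsto_energy_zero (hp : 1 < p) (hpn : p < n) (hlam : 0 < lam)
    (hμ : 0 < μ) (hR : 0 < R) (h : IsPositiveProfile n p μ lam R f q) :
    Tendsto (pohozaevEnergy (riccatiF n p μ) p lam (p / (n - p)) (profileY n p f q)
      (profileH n p f)) (𝓝[>] 0) (𝓝 0) :=
  (h.tendsto_profileH hp hpn hlam hμ hR).zero_mul_isBoundedUnder_le
    (h.isBoundedUnder_energyRatio hp hpn hlam hμ hR)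

theorem IsPositiveProfile.tendsto_energyDefect_zero (hp : 1 < p) (hpn : p < n) (hlam : 0 < lam)
    (hμ : 0 < μ) (hR : 0 < R) (h₁ : IsPositiveProfile n p μ lam R f₁ q₁)
    (h₂ : IsPositiveProfile n p μ lam R f₂ q₂) :
    Tendsto (energyDefect (riccatiF n p μ) p lam (p / (n - p)) (profileY n p f₁ q₁)
      (profileH n p f₁) (profileY n p f₂ q₂) (profileH n p f₂)) (𝓝[>] 0) (𝓝 0) := by
  -- The quotient H₂/H₁ need not be controlled at the origin: H₁ divides out of E₁, leaving H₂ times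
  -- a bounded energy ratio.
  have a := (h₂.tendsto_profileH hp hpn hlam hμ hR).zero_mul_isBoundedUnder_le
    (h₁.isBoundedUnder_energyRatio hp hpn hlam hμ hR)
  have := a.sub (h₂.tendsto_energy_zero hp hpn hlam hμ hR)
  rw [sub_zero] at this
  refine this.congr' ?_
  filter_upwards [Ioo_mem_nhdsGT hR] with r hr
  have := h₁.profileH_pos hr
  simp only [energyDefect, pohozaevEnergy, energyRatio]
  field_simp

/-- A one-dimensional Hopf lemma: the flux is positive and increasing. It makes the boundary slope
nonzero and hence usable as a denominator. -/
theorem IsPositiveProfile.q_R_pos (hR : 0 < R) (h : IsPositiveProfile n p μ lam R f q)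
    (hμ : 0 < μ) (hlam : 0 < lam) : 0 < q R := by
  have hm : StrictMonoOn q (Ioo 0 R) := strictMonoOn_Ioo_of_hasDerivAt_pos h.deriv_q
    fun r hr => by
      have := h.f_pos r hr
      have := hr.1
      positivity
  have hmid : R / 2 ∈ Ioo 0 R := ⟨by linarith, by linarith⟩
  refine (h.q_pos _ hmid).trans_le (ge_of_tendsto h.q_R ?_)
  filter_upwards [Ioo_mem_nhdsLT hmid.2] with s hs
  exact (hm hmid ⟨hmid.1.trans hs.1, hs.2⟩ hs.1).le

theorem IsPositiveProfile.tendsto_slope (hR : 0 < R)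
    (h : IsPositiveProfile n p μ lam R f q) (hμ : 0 < μ) (hlam : 0 < lam) :
    Tendsto (fun r => (q r * r ^ (1 - n)) ^ (1 / (p - 1))) (𝓝[<] R)
      (𝓝 ((q R * R ^ (1 - n)) ^ (1 / (p - 1)))) := by
  have h1 : Tendsto (fun r : ℝ => r ^ (1 - n)) (𝓝[<] R) (𝓝 (R ^ (1 - n))) :=
    (Real.continuousAt_rpow_const R _ (Or.inl hR.ne')).tendsto.mono_left nhdsWithin_le_nhds
  have := h.q_R_pos hR hμ hlam
  exact (h.q_R.mul h1).rpow_const (Or.inl (by positivity))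

/-- Since H y = q f and H y^(p/(p-1)) = q r |f'|, the singular factors 1/f cancel, and only the
latter product has a nonzero limit at R. -/
theorem IsPositiveProfile.tendsto_energy_R (hp : 1 < p) (hpn : p < n) (hlam : 0 < lam)
    (hμ : 0 < μ) (hR : 0 < R) (h : IsPositiveProfile n p μ lam R f q) :
    Tendsto (pohozaevEnergy (riccatiF n p μ) p lam (p / (n - p)) (profileY n p f q)
      (profileH n p f)) (𝓝[<] R)
      (𝓝 ((p - 1) * R ^ n * ((q R * R ^ (1 - n)) ^ (1 / (p - 1))) ^ p)) := by
  have hp' : 0 < p - 1 := by linarith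
  have hnp : 0 < n - p := by linarith
  have hqR := h.q_R_pos hR hμ hlam
  have hs := h.tendsto_slope hR hμ hlam
  have hr : Tendsto (fun r : ℝ => r) (𝓝[<] R) (𝓝 R) := nhdsWithin_le_nhds
  have hH : Tendsto (profileH n p f) (𝓝[<] R) (𝓝 0) := by
    have h1 := hr.rpow_const (p := n - p) (Or.inl hR.ne')
    have h2 := h.f_R.rpow_const (p := p) (Or.inr (by linarith))
    rw [Real.zero_rpow (by linarith)] at h2
    have h3 := h1.mul h2
    rwa [mul_zero] at h3
  have hHσ := hH.rpow_const (p := p / (n - p)) (Or.inr (by positivity))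
  rw [Real.zero_rpow (by positivity)] at hHσ
  have hrp := hr.rpow_const (p := p) (Or.inl hR.ne')
  have key := (((h.q_R.mul hr).mul hs).const_mul (p - 1)).sub ((h.q_R.mul h.f_R).const_mul (n - p))
    |>.add (hH.mul ((tendsto_const_nhds (x := μ)).add (hrp.const_mul lam) |>.add
      (hHσ.const_mul (1 + p / (n - p))⁻¹)))
  have hval : (p - 1) * (q R * R * (q R * R ^ (1 - n)) ^ (1 / (p - 1))) - (n - p) * (q R * 0) +
      0 * (μ + lam * R ^ p + (1 + p / (n - p))⁻¹ * 0) =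
      (p - 1) * R ^ n * ((q R * R ^ (1 - n)) ^ (1 / (p - 1))) ^ p := by
    have hs0 : 0 < (q R * R ^ (1 - n)) ^ (1 / (p - 1)) := by positivity
    have e3 : ((q R * R ^ (1 - n)) ^ (1 / (p - 1))) ^ (p - 1) = q R * R ^ (1 - n) := by
      rw [← Real.rpow_mul (by positivity), one_div_mul_cancel hp'.ne', Real.rpow_one]
    have e5 : ((q R * R ^ (1 - n)) ^ (1 / (p - 1))) ^ p =
        ((q R * R ^ (1 - n)) ^ (1 / (p - 1))) ^ (p - 1) * (q R * R ^ (1 - n)) ^ (1 / (p - 1)) := by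
      rw [← Real.rpow_add_one hs0.ne']; simp
    have e4 : R ^ n * R ^ (1 - n) = R := by rw [← Real.rpow_add hR]; simp
    rw [e5, e3]
    linear_combination (-(p - 1) * q R * (q R * R ^ (1 - n)) ^ (1 / (p - 1))) * e4
  rw [hval] at key
  refine key.congr' ?_
  filter_upwards [Ioo_mem_nhdsLT hR] with r hr
  have h1 := h.f_pos r hr
  have e1 := h.profileH_mul_profileY hr
  simp only [pohozaevEnergy, riccatiF, h.profileY_rpow hp hr]
  have e2 : profileH n p f r * profileY n p f q r *
      ((q r * r ^ (1 - n)) ^ (1 / (p - 1)) * (r / f r)) =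
      q r * r * (q r * r ^ (1 - n)) ^ (1 / (p - 1)) := by
    rw [e1]; field_simp
  linear_combination (n - p) * e1 - (p - 1) * e2

theorem IsPositiveProfile.tendsto_energyDefect_R (hp : 1 < p) (hpn : p < n) (hlam : 0 < lam)
    (hμ : 0 < μ) (hR : 0 < R) (h₁ : IsPositiveProfile n p μ lam R f₁ q₁)
    (h₂ : IsPositiveProfile n p μ lam R f₂ q₂) :
    Tendsto (energyDefect (riccatiF n p μ) p lam (p / (n - p)) (profileY n p f₁ q₁)
      (profileH n p f₁) (profileY n p f₂ q₂) (profileH n p f₂)) (𝓝[<] R) (𝓝 0) := by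
  have hs₁ := h₁.tendsto_slope hR hμ hlam
  have hs₂ := h₂.tendsto_slope hR hμ hlam
  have hq₁ := h₁.q_R_pos hR hμ hlam
  have hq₂ := h₂.q_R_pos hR hμ hlam
  have hs₁0 : 0 < (q₁ R * R ^ (1 - n)) ^ (1 / (p - 1)) := by positivity
  have hs₂0 : 0 < (q₂ R * R ^ (1 - n)) ^ (1 / (p - 1)) := by positivity
  have hratio : Tendsto (fun r => f₂ r / f₁ r) (𝓝[<] R)
      (𝓝 ((q₂ R * R ^ (1 - n)) ^ (1 / (p - 1)) / (q₁ R * R ^ (1 - n)) ^ (1 / (p - 1)))) := by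
    -- Both profiles vanish at R with nonzero slopes, so their quotient tends to the quotient of the
    -- slopes; its p-th power then balances the two boundary energies.
    refine HasDerivAt.lhopital_zero_left_on_Ioo hR h₂.deriv_f h₁.deriv_f (fun r hr => ?_)
      h₂.f_R h₁.f_R ?_
    · have := h₁.q_pos r hr
      have := hr.1
      exact (neg_neg_of_pos (by positivity)).ne
    · refine (hs₂.div hs₁ hs₁0.ne').congr fun r => ?_
      simp [neg_div_neg_eq]
  have hHH : Tendsto (fun r => profileH n p f₂ r / profileH n p f₁ r) (𝓝[<] R)
      (𝓝 (((q₂ R * R ^ (1 - n)) ^ (1 / (p - 1)) / (q₁ R * R ^ (1 - n)) ^ (1 / (p - 1))) ^ p)) := by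
    refine (hratio.rpow_const (p := p) (Or.inr (by linarith))).congr' ?_
    filter_upwards [Ioo_mem_nhdsLT hR] with r hr
    have h3 := hr.1
    have : 0 < r ^ (n - p) := by positivity
    simp only [profileH]
    rw [Real.div_rpow (h₂.f_pos r hr).le (h₁.f_pos r hr).le, mul_div_mul_left _ _ this.ne']
  have key := (hHH.mul (h₁.tendsto_energy_R hp hpn hlam hμ hR)).sub
    (h₂.tendsto_energy_R hp hpn hlam hμ hR)
  refine (key.congr fun _ => rfl).trans (le_of_eq ?_)
  congr 1
  rw [Real.div_rpow hs₂0.le hs₁0.le]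
  have : 0 < ((q₁ R * R ^ (1 - n)) ^ (1 / (p - 1))) ^ p := by positivity
  field_simp
  ring

/-- Uniqueness of the positive radial profile. -/
theorem IsPositiveProfile.eqOn (hp : 1 < p) (hpn : p < n) (hlam : 0 < lam)
    (hμ : 0 < μ) (hR : 0 < R) (h₁ : IsPositiveProfile n p μ lam R f₁ q₁)
    (h₂ : IsPositiveProfile n p μ lam R f₂ q₂) : EqOn f₁ f₂ (Ioo 0 R) := by
  have hnp : 0 < n - p := by linarith
  have hs₁ := h₁.isRiccatiSolution hp hpn
  have hs₂ := h₂.isRiccatiSolution hp hpn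
  obtain ⟨t, ht, hy, hH⟩ := hs₁.exists_eq (fun x hx => hasDerivAt_riccatiF hp hx)
    (strictMonoOn_riccatiF₁ hp) (by positivity) (by linarith) hlam hR hs₂
    (h₁.tendsto_energy_zero hp hpn hlam hμ hR) (h₂.tendsto_energy_zero hp hpn hlam hμ hR)
    (h₁.tendsto_energyDefect_zero hp hpn hlam hμ hR h₂)
    (h₂.tendsto_energyDefect_zero hp hpn hlam hμ hR h₁)
    (h₁.tendsto_energyDefect_R hp hpn hlam hμ hR h₂)
  intro r hr
  have := hs₁.eqOn hs₂ ht hy hH hr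
  have h3 : 0 < r ^ (n - p) := Real.rpow_pos_of_pos hr.1 _
  exact (Real.rpow_left_inj (h₁.f_pos r hr).le (h₂.f_pos r hr).le (by linarith)).1
    (mul_left_cancel₀ h3.ne' this)

end Endpoints


/-! ### Weak derivatives on an interval. -/

section DuBoisReymond

open Set

/-- Smooth functions with compact support in the open interval `(a, b)`. -/
structure IsBump (a b : ℝ) (ψ : ℝ → ℝ) : Prop where
  smooth : ContDiff ℝ ∞ ψ
  compact : HasCompactSupport ψ
  supp : tsupport ψ ⊆ Ioo a b

variable {a b : ℝ}

/-- A compact subset of an open interval lies in a closed subinterval containing a given point. -/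
theorem exists_Icc_of_isCompact {K : Set ℝ} (hK : IsCompact K) (hKab : K ⊆ Ioo a b) {c : ℝ}
    (hc : c ∈ Ioo a b) : ∃ α β, a < α ∧ α < c ∧ c < β ∧ β < b ∧ K ⊆ Ioo α β := by
  have hK' : IsCompact (insert c K) := hK.insert c
  have hne : (insert c K).Nonempty := insert_nonempty c K
  have hsub : insert c K ⊆ Ioo a b := insert_subset hc hKab
  obtain ⟨m, hm, hm'⟩ := hK'.exists_isLeast hne
  obtain ⟨M, hM, hM'⟩ := hK'.exists_isGreatest hne
  obtain ⟨α, h1, h2⟩ := exists_between (hsub hm).1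
  obtain ⟨β, h3, h4⟩ := exists_between (hsub hM).2
  refine ⟨α, β, h1, h2.trans_le (hm' (mem_insert c K)), (hM' (mem_insert c K)).trans_lt h3, h4,
    fun x hx => ⟨h2.trans_le (hm' (mem_insert_of_mem c hx)),
      (hM' (mem_insert_of_mem c hx)).trans_lt h3⟩⟩

theorem IsBump.isBump_deriv {ψ : ℝ → ℝ} (h : IsBump a b ψ) : IsBump a b (deriv ψ) :=
  ⟨(contDiff_infty_iff_deriv.1 h.smooth).2, h.compact.deriv,
    (tsupport_deriv_subset).trans h.supp⟩

theorem IsBump.integrable_mul {ψ F : ℝ → ℝ} (h : IsBump a b ψ)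
    (hF : LocallyIntegrableOn F (Ioo a b)) : Integrable (fun r => F r * ψ r) := by
  have h1 : IntegrableOn F (tsupport ψ) := hF.integrableOn_compact_subset h.supp h.compact
  have h2 : IntegrableOn (fun r => F r * ψ r) (tsupport ψ) :=
    h1.mul_continuousOn h.smooth.continuous.continuousOn h.compact
  rwa [integrableOn_iff_integrable_of_support_subset] at h2
  intro r hr
  exact subset_tsupport ψ (right_ne_zero_of_mul hr)

/-- The primitive of a locally integrable function can be integrated by parts. -/
theorem IsBump.integral_primitive_mul_deriv {ψ g : ℝ → ℝ} (h : IsBump a b ψ)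
    (hg : LocallyIntegrableOn g (Ioo a b)) {c : ℝ} (hc : c ∈ Ioo a b) :
    ∫ r, (∫ s in c..r, g s) * deriv ψ r = -∫ r, g r * ψ r := by
  obtain ⟨α, β, h1, h2, h3, h4, hK⟩ := exists_Icc_of_isCompact h.compact h.supp hc
  have hαβ : α ≤ β := by linarith
  have hgi : IntervalIntegrable g volume α β := by
    rw [intervalIntegrable_iff_integrableOn_Icc_of_le hαβ]
    exact hg.integrableOn_compact_subset (fun x hx => ⟨h1.trans_le hx.1, hx.2.trans_lt h4⟩)
      isCompact_Icc
  have hcm : c ∈ uIcc α β := by rw [uIcc_of_le hαβ]; exact ⟨h2.le, h3.le⟩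
  have hP := hgi.absolutelyContinuousOnInterval_intervalIntegral hcm
  have hψ : AbsolutelyContinuousOnInterval ψ α β :=
    (h.smooth.of_le (by exact_mod_cast le_top)).contDiffOn.absolutelyContinuousOnInterval
  have key := hP.integral_mul_deriv_eq_deriv_mul hψ
  have hz : ∀ x, x ∉ Ioo α β → ψ x = 0 := fun x hx =>
    image_eq_zero_of_notMem_tsupport fun hx' => hx (hK hx')
  have hz' : ∀ x, x ∉ Ioo α β → deriv ψ x = 0 := fun x hx =>
    image_eq_zero_of_notMem_tsupport fun hx' => hx (hK (tsupport_deriv_subset hx'))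
  rw [hz β (by simp), hz α (by simp), mul_zero, mul_zero, sub_zero, zero_sub] at key
  have e1 : ∫ r, (∫ s in c..r, g s) * deriv ψ r =
      ∫ r in α..β, (∫ s in c..r, g s) * deriv ψ r := by
    rw [intervalIntegral.integral_of_le hαβ, setIntegral_eq_integral_of_forall_compl_eq_zero]
    intro x hx
    rw [hz' x fun hx' => hx (Ioo_subset_Ioc_self hx'), mul_zero]
  have e2 : ∫ r, g r * ψ r = ∫ r in α..β, g r * ψ r := by
    rw [intervalIntegral.integral_of_le hαβ, setIntegral_eq_integral_of_forall_compl_eq_zero]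
    intro x hx
    rw [hz x fun hx' => hx (Ioo_subset_Ioc_self hx'), mul_zero]
  rw [e1, e2, key, neg_inj]
  refine intervalIntegral.integral_congr_ae ?_
  filter_upwards [hgi.ae_hasDerivAt_integral] with x hx hx'
  rw [(hx (uIoc_subset_uIcc hx') c hcm).deriv]

theorem exists_isBump_integral_eq_one (hab : a < b) : ∃ χ, IsBump a b χ ∧ ∫ r, χ r = 1 := by
  let B : ContDiffBump ((a + b) / 2) := ⟨(b - a) / 8, (b - a) / 4, by linarith, by linarith⟩
  refine ⟨B.normed volume, ⟨B.contDiff_normed, B.hasCompactSupport_normed, ?_⟩,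
    B.integral_normed⟩
  rw [B.tsupport_normed_eq, Real.closedBall_eq_Icc]
  intro x hx
  simp only [B] at hx
  exact ⟨by linarith [hx.1], by linarith [hx.2]⟩

/-- The primitive started to the left of the support of χ vanishes again to its right because χ has
mean zero. -/
theorem IsBump.exists_primitive {χ : ℝ → ℝ} (h : IsBump a b χ) (hab : a < b)
    (h0 : ∫ r, χ r = 0) : ∃ ψ, IsBump a b ψ ∧ deriv ψ = χ := by
  obtain ⟨c, hc⟩ := exists_between hab
  obtain ⟨α, β, h1, h2, h3, h4, hK⟩ := exists_Icc_of_isCompact h.compact h.supp hc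
  have hcont := h.smooth.continuous
  set ψ : ℝ → ℝ := fun r => ∫ s in α..r, χ s
  have hd : ∀ r, HasDerivAt ψ (χ r) r := fun r => hcont.integral_hasStrictDerivAt α r |>.hasDerivAt
  have hderiv : deriv ψ = χ := funext fun r => (hd r).deriv
  have hz : ∀ x, x ∉ Ioo α β → χ x = 0 := fun x hx =>
    image_eq_zero_of_notMem_tsupport fun hx' => hx (hK hx')
  have hsupp : Function.support ψ ⊆ Icc α β := by
    intro r hr
    by_contra hc'
    apply hr
    rcases lt_or_ge r α with hrα | hrα
    · refine (intervalIntegral.integral_congr (g := fun _ => 0) fun s hs => ?_).trans (by simp)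
      rw [uIcc_of_ge hrα.le] at hs
      exact hz s fun hs' => absurd hs'.1 (not_lt.2 hs.2)
    · have hβ : β < r := by
        by_contra! hβ
        exact hc' ⟨hrα, hβ⟩
      simp only [ψ]
      rw [intervalIntegral.integral_of_le hrα, setIntegral_eq_integral_of_forall_compl_eq_zero, h0]
      intro x hx
      exact hz x fun hx' => hx ⟨hx'.1, hx'.2.le.trans hβ.le⟩
  refine ⟨ψ, ⟨contDiff_infty_iff_deriv.2 ⟨fun r => (hd r).differentiableAt, hderiv ▸ h.smooth⟩,
    HasCompactSupport.of_support_subset_isCompact isCompact_Icc hsupp, ?_⟩, hderiv⟩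
  exact (closure_minimal hsupp isClosed_Icc).trans
    fun x hx => ⟨h1.trans_le hx.1, hx.2.trans_lt h4⟩

theorem continuousOn_primitive {g : ℝ → ℝ} (hg : LocallyIntegrableOn g (Ioo a b)) {c : ℝ}
    (hc : c ∈ Ioo a b) : ContinuousOn (fun r => ∫ s in c..r, g s) (Ioo a b) := by
  intro r hr
  obtain ⟨α, β, h1, h2, h3, h4, hK⟩ := exists_Icc_of_isCompact isCompact_singleton
    (singleton_subset_iff.2 hr) hc
  have hαβ : α ≤ β := by linarith
  have hgi : IntervalIntegrable g volume α β := by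
    rw [intervalIntegrable_iff_integrableOn_Icc_of_le hαβ]
    exact hg.integrableOn_compact_subset (fun x hx => ⟨h1.trans_le hx.1, hx.2.trans_lt h4⟩)
      isCompact_Icc
  have hP := (hgi.absolutelyContinuousOnInterval_intervalIntegral
    (show c ∈ uIcc α β by rw [uIcc_of_le hαβ]; exact ⟨h2.le, h3.le⟩)).continuousOn
  rw [uIcc_of_le hαβ] at hP
  have hr' := singleton_subset_iff.1 hK
  exact (hP.continuousAt (Icc_mem_nhds hr'.1 hr'.2)).continuousWithinAt

/-- **Du Bois-Reymond lemma**: a locally integrable function on an interval with a locally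
integrable weak derivative is almost everywhere a primitive of it. -/
theorem ae_eq_primitive_of_weakDeriv (hab : a < b) {F g : ℝ → ℝ}
    (hF : LocallyIntegrableOn F (Ioo a b)) (hg : LocallyIntegrableOn g (Ioo a b))
    (h : ∀ ψ, IsBump a b ψ → ∫ r, F r * deriv ψ r = -∫ r, g r * ψ r) {c : ℝ}
    (hc : c ∈ Ioo a b) :
    ∃ C, ∀ᵐ r, r ∈ Ioo a b → F r = C + ∫ s in c..r, g s := by
  have hPc := continuousOn_primitive hg hc
  have hP : LocallyIntegrableOn (fun r => ∫ s in c..r, g s) (Ioo a b) :=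
    hPc.locallyIntegrableOn measurableSet_Ioo
  obtain ⟨χ₀, hχ₀, hχ₀1⟩ := exists_isBump_integral_eq_one hab
  set D : ℝ → ℝ := fun r => F r - ∫ s in c..r, g s with hDdef
  have hD : LocallyIntegrableOn D (Ioo a b) := hF.sub hP
  set C := ∫ r, D r * χ₀ r
  have hCint : LocallyIntegrableOn (fun r => D r - C) (Ioo a b) :=
    hD.sub (locallyIntegrableOn_const C)
  refine ⟨C, ?_⟩
  have key := isOpen_Ioo.ae_eq_zero_of_integral_contDiff_smul_eq_zero hCint
    (μ := volume) fun χ h1 h2 h3 => ?_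
  · filter_upwards [key] with r hr hr'
    have := hr hr'
    simp only [hDdef] at this
    linarith
  have hχ : IsBump a b χ := ⟨h1, h2, h3⟩
  set m := ∫ r, χ r
  have hχi : Integrable χ := h1.continuous.integrable_of_hasCompactSupport h2
  have hχ₀i : Integrable χ₀ := hχ₀.smooth.continuous.integrable_of_hasCompactSupport hχ₀.compact
  -- Subtracting the mean along a fixed unit-mass bump makes an arbitrary test function the
  -- derivative of another one; the correction accounts exactly for the constant C.
  have hω : IsBump a b (fun r => χ r - m * χ₀ r) := by
    refine ⟨h1.sub (contDiff_const.mul hχ₀.smooth), h2.sub (hχ₀.compact.mul_left), ?_⟩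
    refine (tsupport_sub _ _).trans (union_subset h3 ?_)
    exact (tsupport_mul_subset_right).trans hχ₀.supp
  obtain ⟨ψ, hψ, hψd⟩ := hω.exists_primitive hab (by
    rw [integral_sub hχi (hχ₀i.const_mul m), integral_const_mul, hχ₀1]; simp [m])
  have e1 := h ψ hψ
  have e2 := hψ.integral_primitive_mul_deriv hg hc
  have e3 : ∫ r, D r * (χ r - m * χ₀ r) = 0 := by
    have : ∫ r, D r * (χ r - m * χ₀ r) =
        (∫ r, F r * deriv ψ r) - ∫ r, (∫ s in c..r, g s) * deriv ψ r := by
      rw [← integral_sub (hψ.isBump_deriv.integrable_mul hF) (hψ.isBump_deriv.integrable_mul hP), hψd]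
      exact integral_congr_ae (ae_of_all _ fun r => by simp only [hDdef]; ring)
    rw [this, e1, e2, sub_self]
  have e4 : ∫ r, D r * (χ r - m * χ₀ r) = (∫ r, D r * χ r) - m * C := by
    rw [← integral_const_mul, ← integral_sub (hχ.integrable_mul hD)
      ((hχ₀.integrable_mul hD).const_mul m)]
    exact integral_congr_ae (ae_of_all _ fun r => by ring)
  calc ∫ r, χ r • (D r - C) = (∫ r, D r * χ r) - ∫ r, C * χ r := by
        rw [← integral_sub (hχ.integrable_mul hD) (hχi.const_mul C)]
        exact integral_congr_ae (ae_of_all _ fun r => by simp only [smul_eq_mul]; ring)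
    _ = 0 := by
        rw [integral_const_mul]
        linarith

end DuBoisReymond


/-! ### Polar coordinates, radial test functions and integration by parts in W₀^{1,p}. -/

section Radial

open Set Metric

variable {N : ℕ}

/-- The surface measure of the unit sphere of `ℝᴺ`. -/
noncomputable def sphereArea (N : ℕ) : ℝ := N * volume.real (ball (0 : Space N) 1)

theorem nontrivial_space (hN : 0 < N) : Nontrivial (Space N) := by
  have : NeZero N := ⟨hN.ne'⟩
  infer_instance

theorem sphereArea_pos (hN : 0 < N) : 0 < sphereArea N := by
  have : 0 < volume.real (ball (0 : Space N) 1) :=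
    ENNReal.toReal_pos (measure_ball_pos volume 0 one_pos).ne' measure_ball_lt_top.ne
  have : (0 : ℝ) < N := by exact_mod_cast hN
  unfold sphereArea
  positivity

theorem integral_radial (hN : 0 < N) (k : ℝ → ℝ) :
    ∫ x : Space N, k ‖x‖ = sphereArea N * ∫ r in Ioi (0 : ℝ), r ^ (N - 1) * k r := by
  have := nontrivial_space hN
  rw [integral_fun_norm_addHaar volume k, finrank_euclideanSpace_fin]
  simp [sphereArea, mul_assoc]

theorem integral_ball_radial (hN : 0 < N) (k : ℝ → ℝ) (R : ℝ) :
    ∫ x in ball (0 : Space N) R, k ‖x‖ =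
      sphereArea N * ∫ r in Ioo 0 R, r ^ (N - 1) * k r := by
  have h1 : ∫ x in ball (0 : Space N) R, k ‖x‖ =
      ∫ x : Space N, (Iio R).indicator k ‖x‖ := by
    rw [← integral_indicator measurableSet_ball]
    refine integral_congr_ae (ae_of_all _ fun x => ?_)
    by_cases hx : ‖x‖ < R <;> simp [indicator, hx]
  have h2 : ∫ r in Ioi (0 : ℝ), r ^ (N - 1) * (Iio R).indicator k r =
      ∫ r in Ioo 0 R, r ^ (N - 1) * k r := by
    have e : (fun r : ℝ => r ^ (N - 1) * (Iio R).indicator k r) =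
        (Iio R).indicator fun r => r ^ (N - 1) * k r := by
      ext r
      by_cases hr : r < R <;> simp [indicator, hr]
    rw [e, setIntegral_indicator measurableSet_Iio]
    rfl
  rw [h1, integral_radial hN, h2]

theorem integrableOn_ball_radial_iff (hN : 0 < N) {k : ℝ → ℝ} {R : ℝ} :
    IntegrableOn (fun x : Space N => k ‖x‖) (ball 0 R) ↔
      IntegrableOn (fun r => r ^ (N - 1) * k r) (Ioo 0 R) := by
  have := nontrivial_space hN
  simpa [finrank_euclideanSpace_fin] using
    integrableOn_fun_norm_addHaar (volume : Measure (Space N)) (f := k) (r := R)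

/-- Null sets of radii correspond to radial null sets. -/
theorem ae_ball_radial_iff (hN : 0 < N) {P : ℝ → Prop} {R : ℝ} :
    (∀ᵐ x ∂(volume.restrict (ball (0 : Space N) R)), P ‖x‖) ↔
      ∀ᵐ r ∂(volume.restrict (Ioo 0 R)), P r := by
  classical
  -- The indicator of the exceptional radii is nonnegative, so vanishing almost everywhere can be
  -- read off from its integral in polar coordinates, without assuming P measurable.
  set k : ℝ → ℝ := {r | ¬ P r}.indicator 1
  have hk : ∀ r, k r = 0 ↔ P r := fun r => by
    by_cases h : P r <;> simp [k, h]
  have hk0 : ∀ r, 0 ≤ k r := fun r => by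
    by_cases h : P r <;> simp [k, h]
  have hint := integral_ball_radial hN k R
  have hω := sphereArea_pos hN
  have hr0 : ∀ᵐ r ∂(volume.restrict (Ioo 0 R)), 0 ≤ r ^ (N - 1) * k r := by
    refine (ae_restrict_iff' measurableSet_Ioo).2 (ae_of_all _ fun r hr => ?_)
    have := hr.1
    have := hk0 r
    positivity
  constructor
  · intro h
    have h0 : (fun x : Space N => k ‖x‖) =ᵐ[volume.restrict (ball 0 R)] 0 := by
      filter_upwards [h] with x hx using (hk _).2 hx
    have hi : IntegrableOn (fun x : Space N => k ‖x‖) (ball 0 R) :=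
      (integrable_zero _ _ _).congr h0.symm
    rw [integral_congr_ae h0] at hint
    simp only [Pi.zero_apply, integral_zero, zero_eq_mul, hω.ne', false_or] at hint
    have := (setIntegral_eq_zero_iff_of_nonneg_ae hr0
      ((integrableOn_ball_radial_iff hN).1 hi)).1 hint
    filter_upwards [this, ae_restrict_mem measurableSet_Ioo] with r hr hr'
    have : r ^ (N - 1) ≠ 0 := pow_ne_zero _ hr'.1.ne'
    exact (hk r).1 ((mul_eq_zero.1 hr).resolve_left this)
  · intro h
    have h0 : (fun r => r ^ (N - 1) * k r) =ᵐ[volume.restrict (Ioo 0 R)] 0 := by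
      filter_upwards [h] with r hr
      simp [(hk r).2 hr]
    have hi : IntegrableOn (fun r => r ^ (N - 1) * k r) (Ioo 0 R) :=
      (integrable_zero _ _ _).congr h0.symm
    rw [integral_congr_ae h0] at hint
    simp only [Pi.zero_apply, integral_zero, mul_zero] at hint
    have := (setIntegral_eq_zero_iff_of_nonneg_ae (ae_of_all _ fun x => hk0 _)
      ((integrableOn_ball_radial_iff hN).2 hi)).1 hint
    filter_upwards [this] with x hx using (hk _).1 hx

theorem hasFDerivAt_norm {x : Space N} (hx : x ≠ 0) :
    HasFDerivAt (fun y : Space N => ‖y‖) (‖x‖⁻¹ • innerSL ℝ x) x := by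
  have hx' : ‖x‖ ≠ 0 := norm_ne_zero_iff.2 hx
  have h := (hasStrictFDerivAt_norm_sq x).hasFDerivAt.sqrt (by positivity)
  simp only [Real.sqrt_sq (norm_nonneg _)] at h
  refine h.congr_fderiv ?_
  ext v
  simp
  field_simp

theorem hasFDerivAt_comp_norm {ψ : ℝ → ℝ} {ψ' : ℝ} {x : Space N} (hx : x ≠ 0)
    (hψ : HasDerivAt ψ ψ' ‖x‖) :
    HasFDerivAt (fun y : Space N => ψ ‖y‖) ((ψ' * ‖x‖⁻¹) • innerSL ℝ x) x := by
  have := hψ.comp_hasFDerivAt x (hasFDerivAt_norm hx)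
  rwa [smul_smul] at this

/-- The support of ψ stays away from 0, the only point where the norm fails to be smooth. -/
theorem IsBump.eventually_zero {b : ℝ} {ψ : ℝ → ℝ} (h : IsBump 0 b ψ) :
    ∀ᶠ x : Space N in 𝓝 0, ψ ‖x‖ = 0 := by
  have h1 : (tsupport ψ)ᶜ ∈ 𝓝 (0 : ℝ) :=
    (isClosed_tsupport ψ).isOpen_compl.mem_nhds fun hc => (h.supp hc).1.false
  have h2 : Tendsto (fun x : Space N => ‖x‖) (𝓝 0) (𝓝 0) := by
    simpa using (continuous_norm (E := Space N)).tendsto 0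
  filter_upwards [h2.eventually h1] with x hx
  exact image_eq_zero_of_notMem_tsupport hx

theorem IsBump.zero_of_notMem {a b r : ℝ} {ψ : ℝ → ℝ} (h : IsBump a b ψ) (hr : r ∉ Ioo a b) :
    ψ r = 0 := image_eq_zero_of_notMem_tsupport fun hc => hr (h.supp hc)

theorem IsBump.fderiv_comp_norm {b : ℝ} {ψ : ℝ → ℝ} (h : IsBump 0 b ψ) (x : Space N) :
    HasFDerivAt (fun y : Space N => ψ ‖y‖) ((deriv ψ ‖x‖ * ‖x‖⁻¹) • innerSL ℝ x) x := by
  rcases eq_or_ne x 0 with rfl | hx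
  · have : HasFDerivAt (fun _ : Space N => (0 : ℝ)) (0 : Space N →L[ℝ] ℝ) 0 :=
      hasFDerivAt_const _ _
    refine (this.congr_of_eventuallyEq h.eventually_zero).congr_fderiv ?_
    simp
  · exact hasFDerivAt_comp_norm hx
      ((h.smooth.differentiable (by simp)).differentiableAt.hasDerivAt)

theorem IsBump.contDiff_comp_norm {b : ℝ} {ψ : ℝ → ℝ} (h : IsBump 0 b ψ) :
    ContDiff ℝ ∞ (fun y : Space N => ψ ‖y‖) := by
  rw [contDiff_iff_contDiffAt]
  intro x
  rcases eq_or_ne x 0 with rfl | hx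
  · exact contDiffAt_const.congr_of_eventuallyEq h.eventually_zero
  · exact h.smooth.contDiffAt.comp x (contDiffAt_norm ℝ hx)

theorem IsBump.tsupport_comp_norm_subset {b : ℝ} {ψ : ℝ → ℝ} (h : IsBump 0 b ψ) :
    tsupport (fun y : Space N => ψ ‖y‖) ⊆ ball 0 b \ {0} := by
  have h1 : tsupport (fun y : Space N => ψ ‖y‖) ⊆ (fun y : Space N => ‖y‖) ⁻¹' tsupport ψ :=
    closure_minimal (fun x hx => subset_tsupport ψ hx)
      ((isClosed_tsupport ψ).preimage continuous_norm)
  intro x hx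
  have : ‖x‖ ∈ Ioo 0 b := h.supp (h1 hx)
  exact ⟨by simpa using this.2, fun hx0 => by
    rw [mem_singleton_iff.1 hx0, norm_zero] at this
    exact this.1.false⟩

theorem IsBump.hasCompactSupport_comp_norm {b : ℝ} {ψ : ℝ → ℝ} (h : IsBump 0 b ψ) :
    HasCompactSupport (fun y : Space N => ψ ‖y‖) :=
  HasCompactSupport.intro (isCompact_closedBall 0 b) fun x hx =>
    h.zero_of_notMem fun hc => hx (by simpa using hc.2.le)

theorem IsBump.isTestFunction {R : ℝ} {ψ : ℝ → ℝ} (h : IsBump 0 R ψ) :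
    IsTestFunction (ball (0 : Space N) R) (fun y => ψ ‖y‖) :=
  ⟨h.contDiff_comp_norm, h.hasCompactSupport_comp_norm,
    h.tsupport_comp_norm_subset.trans sdiff_subset⟩

theorem inner_gradient {φ : Space N → ℝ} (x v : Space N) :
    inner ℝ (gradient φ x) v = fderiv ℝ φ x v := inner_gradient_left

/-- Integration against bounded functions is continuous along `L^p` convergence. -/
theorem tendsto_integral_inner_of_eLpNorm {α F : Type*} [MeasurableSpace α]
    [NormedAddCommGroup F] [InnerProductSpace ℝ F] {ν : Measure α} [IsFiniteMeasure ν]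
    {p : ENNReal} (hp : 1 ≤ p) {f : ℕ → α → F} {g : α → F} (hf : ∀ n, MemLp (f n) p ν)
    (hg : MemLp g p ν) (h : Tendsto (fun n => eLpNorm (fun x => f n x - g x) p ν) atTop (𝓝 0))
    {w : α → F} (hw : AEStronglyMeasurable w ν) {M : ℝ} (hM : ∀ x, ‖w x‖ ≤ M) :
    Tendsto (fun n => ∫ x, inner ℝ (f n x) (w x) ∂ν) atTop (𝓝 (∫ x, inner ℝ (g x) (w x) ∂ν)) := by
  have hbd : ∀ u : α → F, AEStronglyMeasurable u ν →
      eLpNorm (fun x => inner ℝ (u x) (w x)) 1 ν ≤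
        ENNReal.ofReal M * (eLpNorm u p ν * ν univ ^ (1 / (1 : ENNReal).toReal - 1 / p.toReal)) := by
    intro u hu
    refine (eLpNorm_le_mul_eLpNorm_of_ae_le_mul (ae_of_all _ fun x => ?_) 1).trans
      (mul_le_mul_right (eLpNorm_le_eLpNorm_mul_rpow_measure_univ hp hu) _)
    calc ‖inner ℝ (u x) (w x)‖ ≤ ‖u x‖ * ‖w x‖ := norm_inner_le_norm _ _
      _ ≤ ‖u x‖ * M := by gcongr; exact hM x
      _ = M * ‖u x‖ := mul_comm _ _
  have hC : ν univ ^ (1 / (1 : ENNReal).toReal - 1 / p.toReal) ≠ ⊤ := by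
    refine ENNReal.rpow_ne_top_of_nonneg ?_ (measure_ne_top _ _)
    rcases eq_or_ne p ⊤ with rfl | hp'
    · simp
    · have : 1 ≤ p.toReal := by
        rw [← ENNReal.toReal_one]; exact ENNReal.toReal_mono hp' hp
      simp only [ENNReal.toReal_one, div_one, sub_nonneg]
      exact (div_le_one (by linarith)).2 this
  refine tendsto_integral_of_L1' _ (hg.1.inner hw) (Eventually.of_forall fun n => ?_) ?_
  · rw [← memLp_one_iff_integrable]
    refine ⟨(hf n).1.inner hw, (hbd _ (hf n).1).trans_lt ?_⟩
    exact ENNReal.mul_lt_top ENNReal.ofReal_lt_top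
      (ENNReal.mul_lt_top (hf n).2 hC.lt_top)
  · refine tendsto_of_tendsto_of_tendsto_of_le_of_le tendsto_const_nhds
      (h := fun n => ENNReal.ofReal M * (eLpNorm (fun x => f n x - g x) p ν *
        ν univ ^ (1 / (1 : ENNReal).toReal - 1 / p.toReal))) ?_ (fun n => zero_le) (fun n => ?_)
    · have := ENNReal.Tendsto.const_mul (a := ENNReal.ofReal M)
        (ENNReal.Tendsto.mul_const h (Or.inr hC)) (Or.inr ENNReal.ofReal_ne_top)
      simpa using this
    · have := hbd (fun x => f n x - g x) ((hf n).1.sub hg.1)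
      refine le_trans (le_of_eq ?_) this
      congr 1
      ext x
      simp [inner_sub_left]

/-- Functions of `W₀^{1,p}`, extended by zero, can be integrated by parts against all smooth
functions with compact support. -/
theorem MemW01p.integral_mul_fderiv {p : ℝ} (hp : 1 ≤ p) {R : ℝ} {u : Space N → ℝ}
    {G : Space N → Space N} (h : MemW01p p (ball 0 R) u G) {φ : Space N → ℝ}
    (hφ : ContDiff ℝ ∞ φ) (hφc : HasCompactSupport φ) (v : Space N) :
    ∫ x in ball (0 : Space N) R, u x * fderiv ℝ φ x v =
      -∫ x in ball (0 : Space N) R, inner ℝ (G x) v * φ x := by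
  obtain ⟨hu, hG, w, hw, hwu, hwG⟩ := h
  have hp' : 1 ≤ ENNReal.ofReal p := by simpa using hp
  have : IsFiniteMeasure (volume.restrict (ball (0 : Space N) R)) :=
    ⟨by simpa using measure_ball_lt_top⟩
  have hdφ : Continuous fun x => fderiv ℝ φ x v :=
    (hφ.continuous_fderiv (by simp)).clm_apply continuous_const
  have hdφc : HasCompactSupport fun x => fderiv ℝ φ x v := hφc.fderiv_apply ℝ v
  obtain ⟨M₁, hM₁⟩ := hdφc.exists_bound_of_continuous hdφ
  obtain ⟨M₂, hM₂⟩ := (hφc.smul_right (f' := fun _ => v)).exists_bound_of_continuous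
    (hφ.continuous.smul continuous_const)
  have hdw : ∀ n, Continuous (gradient (w n)) := fun n => by
    unfold gradient
    exact (LinearIsometryEquiv.continuous _).comp ((hw n).1.continuous_fderiv (by simp))
  have hdwc : ∀ n, HasCompactSupport (gradient (w n)) := fun n => by
    have : HasCompactSupport (fderiv ℝ (w n)) := (hw n).2.1.fderiv ℝ
    exact this.comp_left (g := (InnerProductSpace.toDual ℝ (Space N)).symm) (map_zero _)
  have e1 := tendsto_integral_inner_of_eLpNorm hp'
    (fun n => ((hw n).1.continuous.memLp_of_hasCompactSupport (hw n).2.1).restrict _) hu hwu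
    (w := fun x => fderiv ℝ φ x v) hdφ.aestronglyMeasurable hM₁
  have e2 := tendsto_integral_inner_of_eLpNorm hp'
    (fun n => ((hdw n).memLp_of_hasCompactSupport (hdwc n)).restrict _) hG hwG
    (w := fun x => φ x • v) (hφ.continuous.smul continuous_const).aestronglyMeasurable hM₂
  -- The approximants are compactly supported in the ball, so no boundary term appears even when φ
  -- does not vanish on the sphere. This carries the zero boundary condition to u.
  have e3 : ∀ n, ∫ x in ball (0 : Space N) R, inner ℝ (w n x) (fderiv ℝ φ x v) =
      -∫ x in ball (0 : Space N) R, inner ℝ (gradient (w n) x) (φ x • v) := by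
    intro n
    have hz : ∀ x ∉ ball (0 : Space N) R, w n x = 0 := fun x hx =>
      image_eq_zero_of_notMem_tsupport fun hc => hx ((hw n).2.2 hc)
    have hz' : ∀ x ∉ ball (0 : Space N) R, gradient (w n) x = 0 := fun x hx => by
      have : fderiv ℝ (w n) x = 0 := image_eq_zero_of_notMem_tsupport fun hc =>
        hx ((hw n).2.2 (tsupport_fderiv_subset ℝ hc))
      simp [gradient, this]
    rw [setIntegral_eq_integral_of_forall_compl_eq_zero fun x hx => by simp [hz x hx],
      setIntegral_eq_integral_of_forall_compl_eq_zero fun x hx => by simp [hz' x hx]]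
    have hdwv : Continuous fun x => fderiv ℝ (w n) x v :=
      ((hw n).1.continuous_fderiv (by simp)).clm_apply continuous_const
    have := integral_mul_fderiv_eq_neg_fderiv_mul_of_integrable (μ := volume) (f := w n) (g := φ)
      (v := v) ((hdwv.mul hφ.continuous).integrable_of_hasCompactSupport hφc.mul_left)
      (((hw n).1.continuous.mul hdφ).integrable_of_hasCompactSupport hdφc.mul_left)
      (((hw n).1.continuous.mul hφ.continuous).integrable_of_hasCompactSupport hφc.mul_left)
      (fun x _ => (hw n).1.differentiable (by simp) x) (fun x _ => hφ.differentiable (by simp) x)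
    calc _ = ∫ x, w n x * fderiv ℝ φ x v := by
          simp only [RCLike.inner_apply, conj_trivial, mul_comm]
      _ = _ := by
          rw [this]
          simp only [inner_smul_right, inner_gradient, mul_comm]
  have e4 := tendsto_nhds_unique e1 ((e2.neg).congr fun n => (e3 n).symm)
  calc _ = ∫ x in ball (0 : Space N) R, inner ℝ (u x) (fderiv ℝ φ x v) := by
        simp only [RCLike.inner_apply, conj_trivial, mul_comm]
    _ = _ := by
        rw [e4]
        simp only [inner_smul_right, mul_comm]

end Radial


/-! ### Radial Sobolev functions as one-dimensional primitives. -/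

section WeakDerivative

open Set Metric

variable {N : ℕ} {p R : ℝ}

/-- The conditional average of an integrable function along the fibres of a real function. -/
theorem exists_fibre_average {Ω : Type*} [MeasurableSpace Ω] {ν : Measure Ω} [IsFiniteMeasure ν]
    {ρ : Ω → ℝ} (hρ : Measurable ρ) {γ : Ω → ℝ} (hγ : Integrable γ ν) :
    ∃ g : ℝ → ℝ, Integrable (fun x => g (ρ x)) ν ∧
      ∀ k : ℝ → ℝ, Continuous k → (∃ M, ∀ r, |k r| ≤ M) →
        ∫ x, k (ρ x) * γ x ∂ν = ∫ x, k (ρ x) * g (ρ x) ∂ν := by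
  have hm := hρ.comap_le
  -- The average is the conditional expectation given the σ-algebra generated by ρ, which factors
  -- through ρ.
  obtain ⟨g, hg, hgeq⟩ := (stronglyMeasurable_condExp (μ := ν)
    (m := MeasurableSpace.comap ρ inferInstance) (f := γ)).exists_eq_measurable_comp
  have hgeq' : (fun x => g (ρ x)) = ν[γ | MeasurableSpace.comap ρ inferInstance] := hgeq.symm
  refine ⟨g, ?_, fun k hk ⟨M, hM⟩ => ?_⟩
  · rw [hgeq']
    exact integrable_condExp
  have hkm : StronglyMeasurable[MeasurableSpace.comap ρ inferInstance] (fun x => k (ρ x)) :=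
    (hk.measurable.comp (comap_measurable ρ)).stronglyMeasurable
  have h1 := condExp_stronglyMeasurable_mul_of_bound hm hkm hγ M
    (ae_of_all _ fun x => hM (ρ x))
  have h2 := integral_condExp hm (μ := ν) (f := (fun x => k (ρ x)) * γ)
  rw [integral_congr_ae h1, ← hgeq'] at h2
  exact h2.symm

/-- The average of an integrable function over spheres. -/
theorem exists_radial_average {γ : Space N → ℝ} (hγ : IntegrableOn γ (ball 0 R)) :
    ∃ g : ℝ → ℝ, IntegrableOn (fun x : Space N => g ‖x‖) (ball 0 R) ∧
      ∀ k : ℝ → ℝ, Continuous k → (∃ M, ∀ r, |k r| ≤ M) →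
        ∫ x in ball (0 : Space N) R, k ‖x‖ * γ x = ∫ x in ball (0 : Space N) R, k ‖x‖ * g ‖x‖ := by
  have : IsFiniteMeasure (volume.restrict (ball (0 : Space N) R)) :=
    ⟨by simpa using measure_ball_lt_top⟩
  exact exists_fibre_average measurable_norm hγ

theorem IsBump.mul_contDiffOn {b : ℝ} {ψ k : ℝ → ℝ} (h : IsBump 0 b ψ)
    (hk : ∀ r, 0 < r → ContDiffAt ℝ ∞ k r) : IsBump 0 b (fun r => ψ r * k r) := by
  refine ⟨?_, h.compact.mul_right, tsupport_mul_subset_left.trans h.supp⟩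
  rw [contDiff_iff_contDiffAt]
  intro r
  by_cases hr : r ∈ tsupport ψ
  · exact h.smooth.contDiffAt.mul (hk r (h.supp hr).1)
  · have : (fun r => ψ r * k r) =ᶠ[𝓝 r] fun _ => 0 := by
      filter_upwards [(isClosed_tsupport ψ).isOpen_compl.mem_nhds hr] with s hs
      rw [image_eq_zero_of_notMem_tsupport hs, zero_mul]
    exact contDiffAt_const.congr_of_eventuallyEq this

theorem IsBump.exists_bound {a b : ℝ} {ψ : ℝ → ℝ} (h : IsBump a b ψ) : ∃ M, ∀ r, |ψ r| ≤ M :=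
  h.compact.exists_bound_of_continuous h.smooth.continuous

theorem integrableOn_of_memLp (hp : 1 ≤ p) {F : Type*} [NormedAddCommGroup F] {u : Space N → F}
    (hu : MemLp u (ENNReal.ofReal p) (volume.restrict (ball 0 R))) :
    IntegrableOn u (ball (0 : Space N) R) := by
  have : IsFiniteMeasure (volume.restrict (ball (0 : Space N) R)) :=
    ⟨by simpa using measure_ball_lt_top⟩
  exact hu.integrable (by simpa using hp)

/-- Testing with the radial field `χ(|x|) x`. -/
theorem MemW01p.integral_divergence (hp : 1 ≤ p) {u : Space N → ℝ}
    {G : Space N → Space N} (h : MemW01p p (ball 0 R) u G) {b : ℝ} {χ : ℝ → ℝ}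
    (hχ : IsBump 0 b χ) :
    ∫ x in ball (0 : Space N) R, u x * (deriv χ ‖x‖ * ‖x‖ + N * χ ‖x‖) =
      -∫ x in ball (0 : Space N) R, χ ‖x‖ * inner ℝ (G x) x := by
  have hu := integrableOn_of_memLp hp h.1
  have hG := integrableOn_of_memLp hp h.2.1
  set e : Fin N → Space N := fun i => EuclideanSpace.single i 1
  have hc := hχ.contDiff_comp_norm (N := N)
  have hcs := hχ.hasCompactSupport_comp_norm (N := N)
  -- Each component of the field is tested in its own coordinate direction; summing over i produces
  -- the divergence.
  have hsm : ∀ i : Fin N, ContDiff ℝ ∞ (fun x : Space N => χ ‖x‖ * x i) := fun i =>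
    hc.mul (by fun_prop)
  have hcm : ∀ i : Fin N, HasCompactSupport (fun x : Space N => χ ‖x‖ * x i) := fun i =>
    hcs.mul_right
  have hfd : ∀ (i : Fin N) (x : Space N), fderiv ℝ (fun x : Space N => χ ‖x‖ * x i) x (e i) =
      deriv χ ‖x‖ * ‖x‖⁻¹ * x i ^ 2 + χ ‖x‖ := by
    intro i x
    have h1 := (hχ.fderiv_comp_norm x).mul
      ((EuclideanSpace.proj i : Space N →L[ℝ] ℝ).hasFDerivAt (x := x))
    have h2 : fderiv ℝ (fun x : Space N => χ ‖x‖ * x i) x = _ := h1.fderiv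
    rw [h2]
    simp [e, EuclideanSpace.inner_single_right]
    ring
  have hsum : ∀ x : Space N, ∑ i, x i ^ 2 = ‖x‖ ^ 2 := fun x => by
    rw [EuclideanSpace.norm_sq_eq]; simp
  have hI : ∀ i, ∫ x in ball (0 : Space N) R, u x * (deriv χ ‖x‖ * ‖x‖⁻¹ * x i ^ 2 + χ ‖x‖) =
      -∫ x in ball (0 : Space N) R, χ ‖x‖ * (G x i * x i) := by
    intro i
    have := h.integral_mul_fderiv hp (hsm i) (hcm i) (e i)
    simp only [hfd] at this
    rw [this]
    congr 1
    refine integral_congr_ae (ae_of_all _ fun x => ?_)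
    simp [e, EuclideanSpace.inner_single_right]
    ring
  have hcont : ∀ i, Continuous (fun x : Space N => deriv χ ‖x‖ * ‖x‖⁻¹ * x i ^ 2 + χ ‖x‖) := by
    intro i
    simp only [← hfd i]
    exact ((hsm i).continuous_fderiv (by simp)).clm_apply continuous_const
  have hcs' : ∀ i, HasCompactSupport
      (fun x : Space N => deriv χ ‖x‖ * ‖x‖⁻¹ * x i ^ 2 + χ ‖x‖) := by
    intro i
    simp only [← hfd i]
    exact (hcm i).fderiv_apply ℝ _
  have hint1 : ∀ i, IntegrableOn (fun x : Space N =>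
      u x * (deriv χ ‖x‖ * ‖x‖⁻¹ * x i ^ 2 + χ ‖x‖)) (ball 0 R) := by
    intro i
    obtain ⟨M, hM⟩ := (hcs' i).exists_bound_of_continuous (hcont i)
    exact hu.mul_bdd (hcont i).aestronglyMeasurable (ae_of_all _ hM)
  have hint2 : ∀ i, IntegrableOn (fun x : Space N => χ ‖x‖ * (G x i * x i)) (ball 0 R) := by
    intro i
    obtain ⟨M, hM⟩ := (hcm i).exists_bound_of_continuous (hsm i).continuous
    have hGi : IntegrableOn (fun x => G x i) (ball (0 : Space N) R) :=
      (EuclideanSpace.proj i : Space N →L[ℝ] ℝ).integrable_comp hG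
    refine (hGi.mul_bdd (hsm i).continuous.aestronglyMeasurable (ae_of_all _ hM)).congr
      (ae_of_all _ fun x => ?_)
    simp only
    ring
  have key := Finset.sum_congr (rfl : (Finset.univ : Finset (Fin N)) = _) fun i _ => hI i
  rw [← integral_finsetSum _ fun i _ => hint1 i, Finset.sum_neg_distrib,
    ← integral_finsetSum _ fun i _ => hint2 i] at key
  calc _ = ∫ x in ball (0 : Space N) R,
        ∑ i, u x * (deriv χ ‖x‖ * ‖x‖⁻¹ * x i ^ 2 + χ ‖x‖) := by
        refine integral_congr_ae (ae_of_all _ fun x => ?_)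
        simp only [← Finset.mul_sum, Finset.sum_add_distrib, hsum, Finset.sum_const,
          Finset.card_univ, Fintype.card_fin, nsmul_eq_mul]
        rcases eq_or_ne ‖x‖ 0 with h0 | h0
        · simp [h0]
        · field_simp
    _ = _ := by
        rw [key]
        congr 1
        refine integral_congr_ae (ae_of_all _ fun x => ?_)
        simp only [← Finset.mul_sum]
        congr 1
        rw [PiLp.inner_apply]
        simp [mul_comm]

/-- The profile of a radial function in `W₀^{1,p}` is weakly differentiable on `(0, ∞)` when
extended by zero. -/
theorem MemW01p.exists_weakDeriv_profile (hN : 0 < N) (hp : 1 ≤ p) {u : Space N → ℝ}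
    {G : Space N → Space N} (h : MemW01p p (ball 0 R) u G) {f : ℝ → ℝ}
    (hf : ∀ᵐ x ∂(volume.restrict (ball (0 : Space N) R)), u x = f ‖x‖) :
    ∃ g : ℝ → ℝ, IntegrableOn (fun r => r ^ (N - 1) * g r) (Ioo 0 R) ∧
      ∀ b ψ, IsBump 0 b ψ →
        ∫ r in Ioo 0 R, f r * deriv ψ r = -∫ r in Ioo 0 R, g r * ψ r := by
  have hG := integrableOn_of_memLp hp h.2.1
  -- This is the radial component of the weak gradient; its spherical average is the candidate for
  -- the derivative of the profile.
  have hγ : IntegrableOn (fun x => inner ℝ (G x) x * ‖x‖⁻¹) (ball (0 : Space N) R) := by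
    refine Integrable.mono hG ?_ (ae_of_all _ fun x => ?_)
    · exact (hG.1.inner aestronglyMeasurable_id).mul
        (measurable_norm.inv.aestronglyMeasurable)
    · rw [norm_mul, norm_inv, norm_norm]
      rcases eq_or_ne ‖x‖ 0 with h0 | h0
      · simp [h0]
      · have : 0 < ‖x‖ := lt_of_le_of_ne (norm_nonneg _) (Ne.symm h0)
        rw [mul_inv_le_iff₀ this]
        exact norm_inner_le_norm _ _
  obtain ⟨g, hg, hgk⟩ := exists_radial_average hγ
  refine ⟨g, (integrableOn_ball_radial_iff hN).1 hg, fun b ψ hψ => ?_⟩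
  have hpow : ∀ r : ℝ, 0 < r → ContDiffAt ℝ ∞ (fun r : ℝ => (r ^ N)⁻¹) r := fun r hr =>
    ContDiffAt.inv (by fun_prop) (pow_ne_zero _ hr.ne')
  -- The weight r^(-N) is chosen because the divergence of ψ(|x|) |x|^(-N) x is |x|^(-(N-1))
  -- ψ'(|x|), and the power cancels the polar Jacobian.
  have hχ := hψ.mul_contDiffOn hpow
  have hχ1 := hψ.mul_contDiffOn (k := fun r => (r ^ N)⁻¹ * r) fun r hr =>
    (hpow r hr).mul contDiffAt_id
  have hrN : ∀ r : ℝ, r ^ N = r ^ (N - 1) * r := fun r => by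
    rw [← pow_succ, Nat.sub_add_cancel hN]
  have key := h.integral_divergence hp hχ
  have hd : ∀ r, 0 < r → deriv (fun r => ψ r * (r ^ N)⁻¹) r * r + N * (ψ r * (r ^ N)⁻¹) =
      (r ^ (N - 1))⁻¹ * deriv ψ r := by
    intro r hr
    have h1 : HasDerivAt (fun r : ℝ => (r ^ N)⁻¹) (-(N * r ^ (N - 1)) / (r ^ N) ^ 2) r :=
      (hasDerivAt_pow N r).inv (pow_ne_zero _ hr.ne')
    have h2 := ((hψ.smooth.differentiable (by simp)).differentiableAt (x := r)).hasDerivAt.mul h1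
    have h3 : deriv (fun r => ψ r * (r ^ N)⁻¹) r = _ := h2.deriv
    rw [h3, hrN r]
    have : r ^ (N - 1) ≠ 0 := pow_ne_zero _ hr.ne'
    field_simp
    ring
  have hL : ∫ x in ball (0 : Space N) R, u x * (deriv (fun r => ψ r * (r ^ N)⁻¹) ‖x‖ * ‖x‖ +
      N * (ψ ‖x‖ * (‖x‖ ^ N)⁻¹)) = sphereArea N * ∫ r in Ioo 0 R, f r * deriv ψ r := by
    rw [← setIntegral_congr_fun (f := fun r => r ^ (N - 1) * (f r *
      (deriv (fun r => ψ r * (r ^ N)⁻¹) r * r + N * (ψ r * (r ^ N)⁻¹)))) measurableSet_Ioo,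
      ← integral_ball_radial hN]
    · refine integral_congr_ae ?_
      filter_upwards [hf] with x hx
      rw [hx]
    · intro r hr
      have : r ^ (N - 1) ≠ 0 := pow_ne_zero _ hr.1.ne'
      simp only [hd r hr.1]
      field_simp
  have hRr : ∫ x in ball (0 : Space N) R, ψ ‖x‖ * (‖x‖ ^ N)⁻¹ * inner ℝ (G x) x =
      sphereArea N * ∫ r in Ioo 0 R, g r * ψ r := by
    rw [← setIntegral_congr_fun (f := fun r => r ^ (N - 1) * ((ψ r * ((r ^ N)⁻¹ * r)) * g r))
      measurableSet_Ioo, ← integral_ball_radial hN, ← hgk _ hχ1.smooth.continuous hχ1.exists_bound]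
    · refine integral_congr_ae (ae_of_all _ fun x => ?_)
      rcases eq_or_ne ‖x‖ 0 with h0 | h0
      · rw [norm_eq_zero.1 h0]; simp
      · simp only
        field_simp
    · intro r hr
      have : r ^ (N - 1) ≠ 0 := pow_ne_zero _ hr.1.ne'
      have := hr.1.ne'
      simp only [hrN r]
      field_simp
  rw [hL, hRr, ← mul_neg] at key
  exact mul_left_cancel₀ (sphereArea_pos hN).ne' key

/-- Local integrability away from the origin of a weighted integrable function. -/
theorem locallyIntegrableOn_indicator {k : ℝ → ℝ} {j : ℕ}
    (hk : IntegrableOn (fun r => r ^ j * k r) (Ioo 0 R)) :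
    LocallyIntegrableOn ((Ioo 0 R).indicator k) (Ioi 0) := by
  have h1 : LocallyIntegrableOn ((Ioo 0 R).indicator fun r => r ^ j * k r) (Ioi 0) :=
    (hk.integrable_indicator measurableSet_Ioo).locallyIntegrable.locallyIntegrableOn _
  have h2 := h1.continuousOn_mul (g := fun r => (r ^ j)⁻¹)
    ((continuousOn_pow j).inv₀ fun r hr => pow_ne_zero _ (ne_of_gt hr)) isOpen_Ioi.isLocallyClosed
  refine h2.congr ?_
  filter_upwards [ae_restrict_mem measurableSet_Ioi] with r hr
  have : r ^ j ≠ 0 := pow_ne_zero _ (ne_of_gt hr)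
  by_cases h : r ∈ Ioo 0 R
  · simp only [indicator_of_mem h]
    field_simp
  · simp [indicator_of_notMem h]

/-- A radial function in `W₀^{1,p}` of a ball is almost everywhere a primitive vanishing at the
boundary. -/
theorem MemW01p.exists_primitive_profile (hN : 0 < N) (hR : 0 < R) (hp : 1 ≤ p)
    {u : Space N → ℝ} {G : Space N → Space N} (h : MemW01p p (ball 0 R) u G) {f : ℝ → ℝ}
    (hf : ∀ᵐ x ∂(volume.restrict (ball (0 : Space N) R)), u x = f ‖x‖) :
    ∃ g : ℝ → ℝ, (∀ r ∉ Ioo 0 R, g r = 0) ∧ IntegrableOn (fun r => r ^ (N - 1) * g r) (Ioo 0 R) ∧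
      ∀ᵐ x ∂(volume.restrict (ball (0 : Space N) R)), u x = ∫ s in R..‖x‖, g s := by
  obtain ⟨g, hg, hgψ⟩ := h.exists_weakDeriv_profile hN hp hf
  have hfi : IntegrableOn (fun x : Space N => f ‖x‖) (ball 0 R) :=
    (integrableOn_of_memLp hp h.1).congr hf
  have hfL := (locallyIntegrableOn_indicator ((integrableOn_ball_radial_iff hN).1 hfi)).mono_set
    (Ioo_subset_Ioi_self : Ioo 0 (2 * R) ⊆ _)
  have hgL := (locallyIntegrableOn_indicator hg).mono_set
    (Ioo_subset_Ioi_self : Ioo 0 (2 * R) ⊆ _)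
  -- Working on (0, 2R) rather than (0, R) captures the boundary condition: test functions may cross
  -- r = R.
  obtain ⟨C, hC⟩ := ae_eq_primitive_of_weakDeriv (by linarith) hfL hgL (c := R) (fun ψ hψ => by
    have e : ∀ k w : ℝ → ℝ, ∫ r, (Ioo 0 R).indicator k r * w r = ∫ r in Ioo 0 R, k r * w r := by
      intro k w
      rw [← integral_indicator measurableSet_Ioo]
      refine integral_congr_ae (ae_of_all _ fun r => ?_)
      by_cases hr : r ∈ Ioo 0 R <;> simp [hr]
    rw [e, e]
    exact hgψ _ ψ hψ) ⟨hR, by linarith⟩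
  -- On (R, 2R) both the zero extension of f and the primitive based at R vanish.
  have hC0 : C = 0 := by
    have h1 : ∃ᵐ r, r ∈ Ioo R (2 * R) := by
      rw [frequently_ae_mem_iff]
      simp [hR]
    obtain ⟨r, hr, hr'⟩ := (h1.and_eventually hC).exists
    have h2 : ∫ s in R..r, (Ioo 0 R).indicator g s = 0 := by
      refine (intervalIntegral.integral_congr (g := fun _ => 0) fun s hs => ?_).trans (by simp)
      rw [uIcc_of_le hr.1.le] at hs
      exact indicator_of_notMem (fun hc => absurd hc.2 (not_lt.2 hs.1)) _
    have h3 := hr' ⟨hR.trans hr.1, hr.2⟩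
    rw [h2, indicator_of_notMem fun hc => absurd hc.2 (not_lt.2 hr.1.le)] at h3
    linarith
  refine ⟨(Ioo 0 R).indicator g, fun r hr => indicator_of_notMem hr _, ?_, ?_⟩
  · refine hg.congr_fun (fun r hr => ?_) measurableSet_Ioo
    simp only [indicator_of_mem hr]
  have h1 : ∀ᵐ r ∂(volume.restrict (Ioo 0 R)), f r = ∫ s in R..r, (Ioo 0 R).indicator g s := by
    rw [ae_restrict_iff' measurableSet_Ioo]
    filter_upwards [hC] with r hr hr'
    have := hr ⟨hr'.1, by linarith [hr'.2]⟩
    rwa [indicator_of_mem hr', hC0, zero_add] at this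
  filter_upwards [hf, (ae_ball_radial_iff hN).2 h1] with x hx hx'
  rw [hx, hx']

end WeakDerivative


/-! ### Identification of the full weak gradient of a radial function. -/

section RadialGradient

open Set Metric

variable {N : ℕ} {p R : ℝ}

/-- Radial primitives can be integrated by parts away from the origin. -/
theorem integral_radial_primitive_mul_fderiv (hN : 0 < N) (hR : 0 < R) {g : ℝ → ℝ}
    (hg : IntegrableOn (fun r => r ^ (N - 1) * g r) (Ioo 0 R))
    (hP : IntegrableOn (fun x : Space N => ∫ s in R..‖x‖, g s) (ball 0 R))
    {φ : Space N → ℝ} (hφ : ContDiff ℝ ∞ φ) (hφc : HasCompactSupport φ)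
    (hφs : tsupport φ ⊆ ball 0 R \ {0}) (v : Space N) :
    ∫ x in ball (0 : Space N) R, (∫ s in R..‖x‖, g s) * fderiv ℝ φ x v =
      -∫ x in ball (0 : Space N) R, g ‖x‖ * (‖x‖⁻¹ * inner ℝ x v * φ x) := by
  obtain ⟨α, β, hα0, hα, -, -, hK⟩ := exists_Icc_of_isCompact (hφc.isCompact.image continuous_norm)
    (a := 0) (b := R) (by
      rintro _ ⟨x, hx, rfl⟩
      exact ⟨norm_pos_iff.2 (hφs hx).2, by simpa using (hφs hx).1⟩)
    (c := R / 2) ⟨by linarith, by linarith⟩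
  have hαR : α < R := by linarith
  have hsupp : ∀ x ∈ tsupport φ, α < ‖x‖ ∧ ‖x‖ < R := fun x hx =>
    ⟨(hK (mem_image_of_mem _ hx)).1, by simpa using (hφs hx).1⟩
  have hdφ : Continuous fun x => fderiv ℝ φ x v :=
    (hφ.continuous_fderiv (by simp)).clm_apply continuous_const
  have hdφc : HasCompactSupport fun x => fderiv ℝ φ x v := hφc.fderiv_apply ℝ v
  have hdφ0 : ∀ x ∉ tsupport φ, fderiv ℝ φ x v = 0 := fun x hx => by
    have : fderiv ℝ φ x = 0 := image_eq_zero_of_notMem_tsupport fun hc =>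
      hx (tsupport_fderiv_subset ℝ hc)
    simp [this]
  obtain ⟨M₁, hM₁⟩ := hdφc.exists_bound_of_continuous hdφ
  obtain ⟨M₀, hM₀⟩ := hφc.exists_bound_of_continuous hφ.continuous
  set w : Space N → ℝ := fun x => ‖x‖⁻¹ * inner ℝ x v * φ x with hw
  have hw0 : ∀ x ∉ tsupport φ, w x = 0 := fun x hx => by
    simp [hw, image_eq_zero_of_notMem_tsupport hx]
  have hwM : ∀ x, ‖w x‖ ≤ ‖v‖ * M₀ := fun x => by
    simp only [hw, norm_mul, norm_inv, norm_norm]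
    refine mul_le_mul ?_ (hM₀ x) (norm_nonneg _) (norm_nonneg _)
    rcases eq_or_ne ‖x‖ 0 with h0 | h0
    · simp [h0]
    · have : 0 < ‖x‖ := lt_of_le_of_ne (norm_nonneg _) (Ne.symm h0)
      rw [inv_mul_le_iff₀ this]
      exact norm_inner_le_norm _ _
  have hwmeas : AEStronglyMeasurable w volume := by
    refine AEStronglyMeasurable.mul (AEStronglyMeasurable.mul ?_ ?_)
      hφ.continuous.aestronglyMeasurable
    · exact measurable_norm.inv.aestronglyMeasurable
    · exact (Continuous.inner continuous_id continuous_const).aestronglyMeasurable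
  -- Only radii met by the support of φ matter. Cutting off below α makes g integrable without the
  -- weight r^(N-1), so that it can be approximated in L¹ by continuous functions with C¹
  -- primitives.
  set gh : ℝ → ℝ := (Ioo α R).indicator g with hgh
  have hghi : Integrable gh := by
    have h1 := (locallyIntegrableOn_indicator hg).integrableOn_compact_subset
      (t := Icc α R) (fun r hr => hα0.trans_le hr.1) isCompact_Icc
    have h2 : IntegrableOn g (Ioo α R) :=
      (h1.mono_set Ioo_subset_Icc_self).congr_fun
        (fun r hr => indicator_of_mem (show r ∈ Ioo 0 R from ⟨hα0.trans hr.1, hr.2⟩) _) measurableSet_Ioo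
    exact h2.integrable_indicator measurableSet_Ioo
  have hghl : IntegrableOn (fun x : Space N => gh ‖x‖) (ball 0 R) := by
    refine (integrableOn_ball_radial_iff hN).2 ?_
    refine (hg.indicator (measurableSet_Ioo (a := α) (b := R))).congr (ae_of_all _ fun r => ?_)
    by_cases hr : r ∈ Ioo α R <;> simp [hgh, hr]
  have hex : ∀ k : ℕ, ∃ gk : ℝ → ℝ, HasCompactSupport gk ∧
      ∫ r, ‖gh r - gk r‖ ≤ 1 / ((k : ℝ) + 1) ∧ Continuous gk ∧ Integrable gk := fun k =>
    hghi.exists_hasCompactSupport_integral_sub_le (by positivity)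
  choose gk hgkc hgkε hgkcont hgki using hex
  have hlim : Tendsto (fun k : ℕ => 1 / ((k : ℝ) + 1)) atTop (𝓝 0) :=
    tendsto_one_div_add_atTop_nhds_zero_nat
  have hPk : ∀ k r, HasDerivAt (fun r => ∫ s in R..r, gk k s) (gk k r) r := fun k r =>
    ((hgkcont k).integral_hasStrictDerivAt R r).hasDerivAt
  have hPkc : ∀ k, Continuous fun r => ∫ s in R..r, gk k s := fun k =>
    continuous_iff_continuousAt.2 fun r => (hPk k r).continuousAt
  have hIBP : ∀ k, ∫ x in ball (0 : Space N) R, (∫ s in R..‖x‖, gk k s) * fderiv ℝ φ x v =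
      -∫ x in ball (0 : Space N) R, gk k ‖x‖ * w x := by
    intro k
    have hx0 : ∀ x ∈ tsupport φ, x ≠ 0 := fun x hx => (hφs hx).2
    have hfd : ∀ x ∈ tsupport φ, HasFDerivAt (fun x : Space N => ∫ s in R..‖x‖, gk k s)
        ((gk k ‖x‖ * ‖x‖⁻¹) • innerSL ℝ x) x := fun x hx =>
      hasFDerivAt_comp_norm (hx0 x hx) (hPk k _)
    have hfd' : ∀ x, fderiv ℝ (fun x : Space N => ∫ s in R..‖x‖, gk k s) x v * φ x =
        gk k ‖x‖ * w x := by
      intro x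
      by_cases hx : x ∈ tsupport φ
      · rw [(hfd x hx).fderiv]
        simp [hw]
        ring
      · simp [hw, image_eq_zero_of_notMem_tsupport hx]
    have hcc : Continuous fun x : Space N => ∫ s in R..‖x‖, gk k s := (hPkc k).comp continuous_norm
    have hi1 : Integrable (fun x => gk k ‖x‖ * w x) := by
      obtain ⟨M, hM⟩ := (hgkc k).exists_bound_of_continuous (hgkcont k)
      have hφi : Integrable (fun x => φ x) := hφ.continuous.integrable_of_hasCompactSupport hφc
      refine Integrable.mono (hφi.const_mul (M * ‖v‖))
        (((hgkcont k).comp continuous_norm).aestronglyMeasurable.mul hwmeas)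
        (ae_of_all _ fun x => ?_)
      have h1 : ‖‖x‖⁻¹ * inner ℝ x v‖ ≤ ‖v‖ := by
        rw [norm_mul, norm_inv, norm_norm]
        rcases eq_or_ne ‖x‖ 0 with h0 | h0
        · simp [h0]
        · have : 0 < ‖x‖ := lt_of_le_of_ne (norm_nonneg _) (Ne.symm h0)
          rw [inv_mul_le_iff₀ this]
          exact norm_inner_le_norm _ _
      have hM0 : 0 ≤ M := (norm_nonneg _).trans (hM 0)
      simp only [hw]
      rw [norm_mul, norm_mul (‖x‖⁻¹ * inner ℝ x v), norm_mul (M * ‖v‖), norm_mul M, norm_norm,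
        Real.norm_of_nonneg hM0, ← mul_assoc]
      gcongr
      exact hM _
    have key := integral_mul_fderiv_eq_neg_fderiv_mul_of_integrable (μ := volume)
      (f := fun x : Space N => ∫ s in R..‖x‖, gk k s) (g := φ) (v := v)
      (by simpa only [hfd'] using hi1)
      ((hcc.mul hdφ).integrable_of_hasCompactSupport hdφc.mul_left)
      ((hcc.mul hφ.continuous).integrable_of_hasCompactSupport hφc.mul_left)
      (fun x hx => (hfd x hx).differentiableAt) (fun x _ => hφ.differentiable (by simp) x)
    simp only [hfd'] at key
    have hout : ∀ x ∉ ball (0 : Space N) R, x ∉ tsupport φ := fun x hx hc => hx (hφs hc).1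
    rw [setIntegral_eq_integral_of_forall_compl_eq_zero fun x hx => by
        rw [hdφ0 x (hout x hx), mul_zero],
      setIntegral_eq_integral_of_forall_compl_eq_zero fun x hx => by
        rw [hw0 x (hout x hx), mul_zero], key]
  -- L¹ closeness of the integrands gives uniform closeness of the primitives, because all are based
  -- at R.
  have hbd : ∀ k r, r ∈ Ioo α R →
      ‖(∫ s in R..r, gk k s) - ∫ s in R..r, g s‖ ≤ 1 / ((k : ℝ) + 1) := by
    intro k r hr
    have e : ∫ s in R..r, g s = ∫ s in R..r, gh s := by
      rw [intervalIntegral.integral_symm, intervalIntegral.integral_symm r]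
      congr 1
      rw [intervalIntegral.integral_of_le hr.2.le, intervalIntegral.integral_of_le hr.2.le,
        integral_Ioc_eq_integral_Ioo, integral_Ioc_eq_integral_Ioo]
      exact setIntegral_congr_fun measurableSet_Ioo fun s hs =>
        (indicator_of_mem (show s ∈ Ioo α R from ⟨hr.1.trans hs.1, hs.2⟩) _).symm
    rw [e, ← intervalIntegral.integral_sub (hgki k).intervalIntegrable hghi.intervalIntegrable]
    refine (intervalIntegral.norm_integral_le_integral_norm_uIoc).trans ?_
    refine (setIntegral_le_integral ((hgki k).sub hghi).norm
      (ae_of_all _ fun s => norm_nonneg _)).trans (le_trans (le_of_eq ?_) (hgkε k))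
    exact integral_congr_ae (ae_of_all _ fun s => norm_sub_rev _ _)
  have hT1 : Tendsto (fun k => ∫ x in ball (0 : Space N) R,
      (∫ s in R..‖x‖, gk k s) * fderiv ℝ φ x v) atTop
      (𝓝 (∫ x in ball (0 : Space N) R, (∫ s in R..‖x‖, g s) * fderiv ℝ φ x v)) := by
    rw [tendsto_iff_norm_sub_tendsto_zero]
    refine squeeze_zero (fun k => norm_nonneg _) (fun k => ?_)
      (g := fun k : ℕ => 1 / ((k : ℝ) + 1) * M₁ * volume.real (ball (0 : Space N) R))
      (by simpa using (hlim.mul_const M₁).mul_const (volume.real (ball (0 : Space N) R)))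
    rw [← integral_sub]
    · refine norm_setIntegral_le_of_norm_le_const measure_ball_lt_top fun x _ => ?_
      rw [← sub_mul, norm_mul]
      by_cases hx : x ∈ tsupport φ
      · exact mul_le_mul (hbd k _ (hsupp x hx)) (hM₁ x) (norm_nonneg _) (by positivity)
      · rw [hdφ0 x hx, norm_zero, mul_zero]
        have : 0 ≤ M₁ := (norm_nonneg _).trans (hM₁ x)
        positivity
    · exact ((((hPkc k).comp continuous_norm).mul hdφ).integrable_of_hasCompactSupport
        hdφc.mul_left).integrableOn
    · exact hP.mul_bdd hdφ.aestronglyMeasurable (ae_of_all _ hM₁)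
  have hgw : ∫ x in ball (0 : Space N) R, g ‖x‖ * w x =
      ∫ x in ball (0 : Space N) R, gh ‖x‖ * w x := by
    refine integral_congr_ae (ae_of_all _ fun x => ?_)
    by_cases hx : x ∈ tsupport φ
    · simp only [hgh, indicator_of_mem (show ‖x‖ ∈ Ioo α R from hsupp x hx)]
    · simp only [hw0 x hx, mul_zero]
  have hT2 : Tendsto (fun k => ∫ x in ball (0 : Space N) R, gk k ‖x‖ * w x) atTop
      (𝓝 (∫ x in ball (0 : Space N) R, g ‖x‖ * w x)) := by
    rw [hgw, tendsto_iff_norm_sub_tendsto_zero]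
    have hgkl : ∀ k, IntegrableOn (fun x : Space N => gk k ‖x‖) (ball 0 R) := fun k =>
      (((hgkcont k).comp continuous_norm).continuousOn.integrableOn_compact
        (isCompact_closedBall 0 R)).mono_set ball_subset_closedBall
    refine squeeze_zero (fun k => norm_nonneg _) (fun k => ?_)
      (g := fun k : ℕ => sphereArea N * (R ^ (N - 1) * (1 / ((k : ℝ) + 1))) * (‖v‖ * M₀))
      (by
        have := ((hlim.const_mul (R ^ (N - 1))).const_mul (sphereArea N)).mul_const (‖v‖ * M₀)
        simpa using this)
    have hi : IntegrableOn (fun x : Space N => gk k ‖x‖ - gh ‖x‖) (ball 0 R) := (hgkl k).sub hghl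
    have hi' : IntegrableOn (fun x : Space N => ‖gk k ‖x‖ - gh ‖x‖‖) (ball 0 R) := hi.norm
    rw [← integral_sub ((hgkl k).mul_bdd hwmeas.restrict (ae_of_all _ hwM))
      (hghl.mul_bdd hwmeas.restrict (ae_of_all _ hwM))]
    calc _ ≤ ∫ x in ball (0 : Space N) R, ‖gk k ‖x‖ - gh ‖x‖‖ * (‖v‖ * M₀) := by
          refine norm_integral_le_of_norm_le (hi'.mul_const _) (ae_of_all _ fun x => ?_)
          rw [← sub_mul, norm_mul]
          gcongr
          exact hwM x
      _ = sphereArea N * (∫ r in Ioo 0 R, r ^ (N - 1) * ‖gk k r - gh r‖) * (‖v‖ * M₀) := by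
          rw [integral_mul_const, integral_ball_radial hN (fun r => ‖gk k r - gh r‖)]
      _ ≤ _ := by
          have hM0 : 0 ≤ M₀ := (norm_nonneg _).trans (hM₀ 0)
          have hω := sphereArea_pos hN
          gcongr
          have hn : Integrable fun r => ‖gk k r - gh r‖ := ((hgki k).sub hghi).norm
          calc _ ≤ ∫ r in Ioo 0 R, R ^ (N - 1) * ‖gk k r - gh r‖ := by
                refine setIntegral_mono_on ((integrableOn_ball_radial_iff hN).1 hi')
                  (hn.const_mul _).integrableOn measurableSet_Ioo fun r hr => ?_
                have := hr.1.le
                have := hr.2.le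
                gcongr
            _ ≤ R ^ (N - 1) * (1 / ((k : ℝ) + 1)) := by
                rw [integral_const_mul]
                gcongr
                refine (setIntegral_le_integral hn (ae_of_all _ fun s => norm_nonneg _)).trans
                  (le_trans (le_of_eq ?_) (hgkε k))
                exact integral_congr_ae (ae_of_all _ fun s => norm_sub_rev _ _)
  exact tendsto_nhds_unique hT1 (hT2.neg.congr fun k => (hIBP k).symm)

/-- The weak gradient of a radial function is radial. -/
theorem MemW01p.ae_gradient_radial (hN : 0 < N) (hR : 0 < R) (hp : 1 ≤ p)
    {u : Space N → ℝ} {G : Space N → Space N} (h : MemW01p p (ball 0 R) u G) {g : ℝ → ℝ}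
    (hg : IntegrableOn (fun r => r ^ (N - 1) * g r) (Ioo 0 R))
    (hu : ∀ᵐ x ∂(volume.restrict (ball (0 : Space N) R)), u x = ∫ s in R..‖x‖, g s) :
    ∀ᵐ x ∂(volume.restrict (ball (0 : Space N) R)), G x = (g ‖x‖ * ‖x‖⁻¹) • x := by
  have hnt := nontrivial_space hN
  have hG := integrableOn_of_memLp hp h.2.1
  have hP : IntegrableOn (fun x : Space N => ∫ s in R..‖x‖, g s) (ball 0 R) :=
    (integrableOn_of_memLp hp h.1).congr hu
  have hgl : IntegrableOn (fun x : Space N => g ‖x‖) (ball 0 R) :=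
    (integrableOn_ball_radial_iff hN).2 hg
  have hunit : Measurable fun x : Space N => ‖x‖⁻¹ • x := measurable_norm.inv.smul measurable_id
  have hunit1 : ∀ x : Space N, ‖‖x‖⁻¹ • x‖ ≤ 1 := fun x => by
    rw [norm_smul, norm_inv, norm_norm]
    exact inv_mul_le_one
  have hgx : IntegrableOn (fun x : Space N => (g ‖x‖ * ‖x‖⁻¹) • x) (ball 0 R) := by
    simp only [mul_smul]
    exact hgl.smul_bdd 1 hunit.aestronglyMeasurable (ae_of_all _ hunit1)
  have hD : IntegrableOn (fun x => G x - (g ‖x‖ * ‖x‖⁻¹) • x) (ball 0 R) := hG.sub hgx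
  -- Test functions supported off the origin suffice, since a single point is a null set.
  have hU : IsOpen (ball (0 : Space N) R \ {0}) := isOpen_ball.sdiff isClosed_singleton
  have key := hU.ae_eq_zero_of_integral_contDiff_smul_eq_zero (μ := volume)
    (hD.mono_set sdiff_subset).locallyIntegrableOn fun φ hφ hφc hφs => ?_
  · rw [ae_restrict_iff' measurableSet_ball]
    have h0 : ∀ᵐ x : Space N, x ≠ 0 := compl_mem_ae_iff.2 (measure_singleton 0)
    filter_upwards [key, h0] with x hx hx0 hxB
    exact sub_eq_zero.1 (hx ⟨hxB, hx0⟩)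
  obtain ⟨M₀, hM₀⟩ := hφc.exists_bound_of_continuous hφ.continuous
  have hφG : IntegrableOn (fun x => φ x • (G x - (g ‖x‖ * ‖x‖⁻¹) • x)) (ball 0 R) :=
    hD.bdd_smul M₀ hφ.continuous.aestronglyMeasurable (ae_of_all _ hM₀)
  rw [← setIntegral_eq_integral_of_forall_compl_eq_zero (s := ball (0 : Space N) R) fun x hx => by
    rw [image_eq_zero_of_notMem_tsupport fun hc => hx (hφs hc).1, zero_smul]]
  refine ext_inner_left ℝ fun v => ?_
  rw [← integral_inner hφG, inner_zero_right]
  have e1 := h.integral_mul_fderiv hp hφ hφc v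
  have e2 := integral_radial_primitive_mul_fderiv hN hR hg hP hφ hφc hφs v
  have e3 : ∫ x in ball (0 : Space N) R, u x * fderiv ℝ φ x v =
      ∫ x in ball (0 : Space N) R, (∫ s in R..‖x‖, g s) * fderiv ℝ φ x v := by
    refine integral_congr_ae ?_
    filter_upwards [hu] with x hx
    rw [hx]
  have hi1 : IntegrableOn (fun x => inner ℝ (G x) v * φ x) (ball (0 : Space N) R) :=
    (hG.inner_const v).mul_bdd hφ.continuous.aestronglyMeasurable (ae_of_all _ hM₀)
  have hi2 : IntegrableOn (fun x => g ‖x‖ * (‖x‖⁻¹ * inner ℝ x v * φ x)) (ball (0 : Space N) R) := by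
    refine ((hgx.inner_const v).mul_bdd hφ.continuous.aestronglyMeasurable
      (ae_of_all _ hM₀)).congr (ae_of_all _ fun x => ?_)
    simp only [inner_smul_left, RCLike.conj_to_real]
    ring
  calc _ = ∫ x in ball (0 : Space N) R, (inner ℝ (G x) v * φ x -
        g ‖x‖ * (‖x‖⁻¹ * inner ℝ x v * φ x)) := by
        refine integral_congr_ae (ae_of_all _ fun x => ?_)
        simp only [inner_smul_right, inner_sub_right, real_inner_comm v]
        ring
    _ = 0 := by
        rw [integral_sub hi1 hi2]
        linarith

end RadialGradient


/-! ### Odd powers, used to pass between the derivative and the flux. -/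

section SignedPower

open Set

/-- The odd power function `|x| ^ (s - 1) x`. -/
noncomputable def signedPow (s x : ℝ) : ℝ := |x| ^ (s - 1) * x

theorem signedPow_of_nonneg {s x : ℝ} (hs : 0 < s) (hx : 0 ≤ x) : signedPow s x = x ^ s := by
  rw [signedPow, abs_of_nonneg hx]
  rcases hx.eq_or_lt with rfl | hx
  · simp [hs.ne']
  · rw [← Real.rpow_add_one hx.ne', sub_add_cancel]

theorem signedPow_neg (s x : ℝ) : signedPow s (-x) = -signedPow s x := by
  simp [signedPow]

theorem signedPow_signedPow {s t x : ℝ} (hs : 0 < s) (ht : 0 < t) (hst : t * s = 1) :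
    signedPow s (signedPow t x) = x := by
  rcases le_total 0 x with hx | hx
  · rw [signedPow_of_nonneg ht hx, signedPow_of_nonneg hs (Real.rpow_nonneg hx _),
      ← Real.rpow_mul hx, hst, Real.rpow_one]
  · obtain ⟨y, rfl⟩ : ∃ y, x = -y := ⟨-x, (neg_neg x).symm⟩
    have hy : 0 ≤ y := by linarith
    rw [signedPow_neg, signedPow_neg, signedPow_of_nonneg ht hy,
      signedPow_of_nonneg hs (Real.rpow_nonneg hy _), ← Real.rpow_mul hy, hst, Real.rpow_one]

theorem signedPow_eq {s : ℝ} (hs : 0 < s) (x : ℝ) :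
    signedPow s x = max x 0 ^ s - max (-x) 0 ^ s := by
  rcases le_total 0 x with hx | hx
  · rw [signedPow_of_nonneg hs hx, max_eq_left hx, max_eq_right (by linarith),
      Real.zero_rpow hs.ne', sub_zero]
  · obtain ⟨y, rfl⟩ : ∃ y, x = -y := ⟨-x, (neg_neg x).symm⟩
    have hy : 0 ≤ y := by linarith
    rw [signedPow_neg, signedPow_of_nonneg hs hy, max_eq_right hx, neg_neg, max_eq_left hy,
      Real.zero_rpow hs.ne', zero_sub]

theorem continuous_signedPow {s : ℝ} (hs : 0 < s) : Continuous (signedPow s) := by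
  have : signedPow s = fun x => max x 0 ^ s - max (-x) 0 ^ s := funext (signedPow_eq hs)
  rw [this]
  have h1 : Continuous fun x : ℝ => max x 0 ^ s :=
    (continuous_id.max continuous_const).rpow_const fun _ => Or.inr hs.le
  have h2 : Continuous fun x : ℝ => max (-x) 0 ^ s :=
    (continuous_id.neg.max continuous_const).rpow_const fun _ => Or.inr hs.le
  exact h1.sub h2

theorem abs_signedPow {s : ℝ} (hs : 0 < s) (x : ℝ) : |signedPow s x| = |x| ^ s := by
  rw [signedPow, abs_mul, abs_of_nonneg (Real.rpow_nonneg (abs_nonneg x) _)]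
  have := signedPow_of_nonneg hs (abs_nonneg x)
  rwa [signedPow, abs_abs] at this

theorem signedPow_pos {s x : ℝ} (hx : 0 < x) : 0 < signedPow s x := by
  unfold signedPow
  have : |x| ≠ 0 := by positivity
  positivity

end SignedPower

/-! ### Strict positivity of the profile and of its flux. -/

section Positivity

open Set

/-- `f` is the profile of a nonnegative radial solution in the ball of radius `R`, with flux `q`. -/
structure IsNonnegProfile (n p μ lam R : ℝ) (f q : ℝ → ℝ) : Prop where
  f_nonneg : ∀ r ∈ Ioo 0 R, 0 ≤ f r
  f_pos_ae : ∀ᵐ r ∂(volume.restrict (Ioo 0 R)), 0 < f r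
  deriv_f : ∀ r ∈ Ioo 0 R, HasDerivAt f (-signedPow (1 / (p - 1)) (q r * r ^ (1 - n))) r
  deriv_q : ∀ r ∈ Ioo 0 R, HasDerivAt q
    (r ^ (n - 1) * (f r ^ (p - 1) * (μ * r ^ (-p) + lam + f r ^ (p * (p / (n - p)))))) r
  f_R : Tendsto f (𝓝[<] R) (𝓝 0)
  q_R : Tendsto q (𝓝[<] R) (𝓝 (q R))
  energy : IntegrableOn (fun r => r ^ (n - 1) * |signedPow (1 / (p - 1)) (q r * r ^ (1 - n))| ^ p)
    (Ioo 0 R)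

variable {n p μ lam R : ℝ} {f q : ℝ → ℝ}

theorem IsNonnegProfile.monotoneOn_q (hlam : 0 < lam) (hμ : 0 < μ)
    (h : IsNonnegProfile n p μ lam R f q) : MonotoneOn q (Ioo 0 R) := by
  refine monotoneOn_of_hasDerivWithinAt_nonneg (convex_Ioo 0 R)
    (fun r hr => (h.deriv_q r hr).continuousAt.continuousWithinAt)
    (fun r hr => (h.deriv_q r (interior_subset hr)).hasDerivWithinAt) fun r hr => ?_
  have h1 := h.f_nonneg r (interior_subset hr)
  have h2 := (interior_subset hr).1
  positivity

/-- An interior zero is a minimum, so q ≤ 0 there and, by monotonicity, at all smaller radii. Then f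
increases up to the zero and is nonpositive before it, against positivity almost everywhere. -/
theorem IsNonnegProfile.f_pos (hlam : 0 < lam) (hμ : 0 < μ)
    (h : IsNonnegProfile n p μ lam R f q) {r : ℝ} (hr : r ∈ Ioo 0 R) : 0 < f r := by
  refine lt_of_le_of_ne (h.f_nonneg r hr) fun h0 => ?_
  have hmin : IsLocalMin f r := by
    filter_upwards [isOpen_Ioo.mem_nhds hr] with s hs
    rw [← h0]
    exact h.f_nonneg s hs
  have hd := hmin.hasDerivAt_eq_zero (h.deriv_f r hr)
  have hpw : 0 < r ^ (1 - n) := Real.rpow_pos_of_pos hr.1 _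
  have hq : q r ≤ 0 := by
    by_contra! hq
    have := signedPow_pos (s := 1 / (p - 1)) (mul_pos hq hpw)
    linarith
  have hsub : Ioc 0 r ⊆ Ioo 0 R := fun s hs => ⟨hs.1, hs.2.trans_lt hr.2⟩
  have hmono : MonotoneOn f (Ioc 0 r) := by
    refine monotoneOn_of_hasDerivWithinAt_nonneg (convex_Ioc 0 r)
      (fun s hs => (h.deriv_f s (hsub hs)).continuousAt.continuousWithinAt)
      (fun s hs => (h.deriv_f s (hsub (interior_subset hs))).hasDerivWithinAt) fun s hs => ?_
    have hs' := interior_subset hs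
    have h1 : q s ≤ 0 := (h.monotoneOn_q hlam hμ (hsub hs') hr hs'.2).trans hq
    have h2 : 0 < s ^ (1 - n) := Real.rpow_pos_of_pos hs'.1 _
    have h3 : signedPow (1 / (p - 1)) (q s * s ^ (1 - n)) ≤ 0 := by
      unfold signedPow
      exact mul_nonpos_of_nonneg_of_nonpos (Real.rpow_nonneg (abs_nonneg _) _)
        (mul_nonpos_of_nonpos_of_nonneg h1 h2.le)
    linarith
  have hae : ∀ᵐ s ∂(volume.restrict (Ioo 0 r)), False := by
    filter_upwards [ae_restrict_of_ae_restrict_of_subset (Ioo_subset_Ioo_right hr.2.le) h.f_pos_ae,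
      ae_restrict_mem measurableSet_Ioo] with s hs hs'
    have := hmono ⟨hs'.1, hs'.2.le⟩ ⟨hr.1, le_rfl⟩ hs'.2.le
    linarith
  rw [eventually_false_iff_eq_bot, ae_eq_bot, Measure.restrict_eq_zero, Real.volume_Ioo] at hae
  simp at hae
  linarith [hr.1]

/-- A nonpositive value makes q at most a negative constant near 0. Then f' ≥ K/r, because
(n-1)/(p-1) ≥ 1, and f falls at least logarithmically towards the origin, losing its positivity. -/
theorem IsNonnegProfile.q_pos (hp : 1 < p) (hpn : p < n) (hlam : 0 < lam) (hμ : 0 < μ)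
    (h : IsNonnegProfile n p μ lam R f q) {r : ℝ} (hr : r ∈ Ioo 0 R) : 0 < q r := by
  by_contra! hq
  have hp' : 0 < p - 1 := by linarith
  have hstrict : StrictMonoOn q (Ioo 0 R) := by
    refine strictMonoOn_Ioo_of_hasDerivAt_pos h.deriv_q fun s hs => ?_
    have := h.f_pos hlam hμ hs
    have := hs.1
    positivity
  set t := r / 2 with ht
  have htR : t ∈ Ioo 0 R := ⟨by linarith [hr.1], by linarith [hr.1, hr.2]⟩
  have ht0 : 0 < t := htR.1
  have hqt : q t < 0 := (hstrict htR hr (by linarith [hr.1])).trans_le hq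
  set c := -q t with hc
  have hc0 : 0 < c := by linarith
  set e := 1 - (n - 1) / (p - 1) with he
  have he0 : e ≤ 0 := by
    have : 1 ≤ (n - 1) / (p - 1) := by rw [le_div_iff₀ hp']; linarith
    linarith
  set K := c ^ (1 / (p - 1)) * t ^ e with hK
  have hK0 : 0 < K := by positivity
  have hsub : Ioc 0 t ⊆ Ioo 0 R := fun s hs => ⟨hs.1, hs.2.trans_lt htR.2⟩
  have hmono : MonotoneOn (fun s => f s - K * Real.log s) (Ioc 0 t) := by
    refine monotoneOn_of_hasDerivWithinAt_nonneg (convex_Ioc 0 t)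
      (f' := fun s => -signedPow (1 / (p - 1)) (q s * s ^ (1 - n)) - K * s⁻¹)
      (fun s hs => ((h.deriv_f s (hsub hs)).sub
        ((Real.hasDerivAt_log hs.1.ne').const_mul K)).continuousAt.continuousWithinAt)
      (fun s hs => ((h.deriv_f s (hsub (interior_subset hs))).sub
        ((Real.hasDerivAt_log (interior_subset hs).1.ne').const_mul K)).hasDerivWithinAt)
      fun s hs => ?_
    have hs' := interior_subset hs
    have hs0 : 0 < s := hs'.1
    have h1 : c ≤ -q s := neg_le_neg (h.monotoneOn_q hlam hμ (hsub hs') htR hs'.2)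
    have h2 : 0 < s ^ (1 - n) := Real.rpow_pos_of_pos hs0 _
    have h3 : -signedPow (1 / (p - 1)) (q s * s ^ (1 - n)) =
        (-q s * s ^ (1 - n)) ^ (1 / (p - 1)) := by
      rw [← signedPow_neg, ← neg_mul, signedPow_of_nonneg (by positivity)]
      exact mul_nonneg (by linarith) h2.le
    have h4 : (c * s ^ (1 - n)) ^ (1 / (p - 1)) ≤ (-q s * s ^ (1 - n)) ^ (1 / (p - 1)) := by
      gcongr
    have h5 : (c * s ^ (1 - n)) ^ (1 / (p - 1)) = c ^ (1 / (p - 1)) * (s ^ e * s⁻¹) := by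
      rw [Real.mul_rpow hc0.le h2.le, ← Real.rpow_mul hs0.le, ← Real.rpow_neg_one s,
        ← Real.rpow_add hs0]
      congr 2
      rw [he]
      field_simp
      ring
    have h6 : t ^ e ≤ s ^ e := Real.rpow_le_rpow_of_nonpos hs0 hs'.2 he0
    have h7 : K * s⁻¹ ≤ c ^ (1 / (p - 1)) * (s ^ e * s⁻¹) := by
      rw [hK, mul_assoc]
      gcongr
    linarith
  have hft := h.f_pos hlam hμ htR
  -- The radius at which the logarithmic upper bound f(t) + K log(s/t) reaches zero.
  set s := t * Real.exp (-(f t / K)) with hs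
  have hs0 : 0 < s := by positivity
  have hst : s ≤ t := by
    have : Real.exp (-(f t / K)) ≤ 1 := Real.exp_le_one_iff.2 (by
      have : 0 < f t / K := by positivity
      linarith)
    exact mul_le_of_le_one_right ht0.le this
  have h1 := hmono ⟨hs0, hst⟩ ⟨ht0, le_rfl⟩ hst
  have h2 : Real.log s = Real.log t - f t / K := by
    rw [hs, Real.log_mul ht0.ne' (Real.exp_pos _).ne', Real.log_exp]
    ring
  have h3 := h.f_pos hlam hμ (hsub ⟨hs0, hst⟩)
  simp only [h2] at h1
  have h4 : K * (Real.log t - f t / K) = K * Real.log t - f t := by field_simp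
  linarith

theorem IsNonnegProfile.isPositiveProfile (hp : 1 < p) (hpn : p < n) (hlam : 0 < lam) (hμ : 0 < μ)
    (h : IsNonnegProfile n p μ lam R f q) : IsPositiveProfile n p μ lam R f q := by
  have hp' : 0 < p - 1 := by linarith
  have e : ∀ r ∈ Ioo 0 R, signedPow (1 / (p - 1)) (q r * r ^ (1 - n)) =
      (q r * r ^ (1 - n)) ^ (1 / (p - 1)) := fun r hr =>
    signedPow_of_nonneg (by positivity)
      (mul_pos (h.q_pos hp hpn hlam hμ hr) (Real.rpow_pos_of_pos hr.1 _)).le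
  exact
  { f_pos := fun r hr => h.f_pos hlam hμ hr
    q_pos := fun r hr => h.q_pos hp hpn hlam hμ hr
    deriv_f := fun r hr => e r hr ▸ h.deriv_f r hr
    deriv_q := h.deriv_q
    f_R := h.f_R
    q_R := h.q_R
    energy := h.energy.congr_fun (fun r hr => by
      have h1 := h.q_pos hp hpn hlam hμ hr
      have h2 := hr.1
      simp only [e r hr]
      rw [abs_of_pos (by positivity)]) measurableSet_Ioo }

end Positivity


/-! ### From weak solutions to classical profiles. -/

section WeakSolution

open Set Metric

variable {N : ℕ} {p μ lam R : ℝ}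

theorem pow_sub_one_eq_rpow (hN : 0 < N) (r : ℝ) : r ^ (N - 1) = r ^ ((N : ℝ) - 1) := by
  rw [← Real.rpow_natCast, Nat.cast_sub hN, Nat.cast_one]

theorem setIntegral_mul_bump {k ψ : ℝ → ℝ} (hψ : IsBump 0 R ψ) :
    ∫ r in Ioo 0 R, k r * ψ r = ∫ r, k r * ψ r :=
  setIntegral_eq_integral_of_forall_compl_eq_zero fun r hr => by
    rw [hψ.zero_of_notMem hr, mul_zero]

/-- The weak formulation of the radial problem in one dimension. -/
theorem IsBump.weak_radial_equation (hN : 0 < N) (hp : 1 < p) (hpN : p < N)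
    {u : Space N → ℝ} {G : Space N → Space N}
    (hweak : ∀ φ : Space N → ℝ, IsTestFunction (ball 0 R) φ →
      ∫ x in ball (0 : Space N) R, (‖G x‖ ^ (p - 2) * inner ℝ (G x) (gradient φ x)
          - μ / ‖x‖ ^ p * (|u x| ^ (p - 2) * u x) * φ x
          - lam * (|u x| ^ (p - 2) * u x) * φ x)
        = ∫ x in ball (0 : Space N) R, |u x| ^ (critExp N p - 2) * u x * φ x)
    {f g : ℝ → ℝ} (hu : ∀ᵐ x ∂(volume.restrict (ball (0 : Space N) R)), u x = f ‖x‖)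
    (hG : ∀ᵐ x ∂(volume.restrict (ball (0 : Space N) R)), G x = (g ‖x‖ * ‖x‖⁻¹) • x)
    (hf0 : ∀ r ∈ Ioo 0 R, 0 ≤ f r) (hfc : ContinuousOn f (Ioo 0 R))
    (hA : LocallyIntegrableOn (fun r => r ^ ((N : ℝ) - 1) * signedPow (p - 1) (g r)) (Ioo 0 R))
    {ψ : ℝ → ℝ} (hψ : IsBump 0 R ψ) :
    ∫ r, r ^ ((N : ℝ) - 1) * signedPow (p - 1) (g r) * deriv ψ r =
      ∫ r, r ^ ((N : ℝ) - 1) * (f r ^ (p - 1) *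
        (μ * r ^ (-p) + lam + f r ^ (p * (p / (N - p))))) * ψ r := by
  have hnt := nontrivial_space hN
  have hp' : 0 < p - 1 := by linarith
  have hNp : 0 < (N : ℝ) - p := by linarith
  have hσ : 0 < p * (p / (N - p)) := by positivity
  -- That is, p* - p = p σ with σ = p/(N-p), the exponent appearing in the profile equation.
  have hcrit : critExp N p - 1 = (p - 1) + p * (p / (N - p)) := by
    rw [critExp]; field_simp; ring
  have key := hweak _ hψ.isTestFunction
  have hne : ∀ᵐ x ∂(volume.restrict (ball (0 : Space N) R)), x ≠ 0 :=
    ae_restrict_of_ae (compl_mem_ae_iff.2 (measure_singleton 0))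
  set K₁ : ℝ → ℝ := fun r => signedPow (p - 1) (g r) * deriv ψ r -
    f r ^ (p - 1) * (μ * r ^ (-p) + lam) * ψ r with hK₁
  set K₂ : ℝ → ℝ := fun r => f r ^ (p - 1) * f r ^ (p * (p / (N - p))) * ψ r with hK₂
  have e1 : ∫ x in ball (0 : Space N) R, (‖G x‖ ^ (p - 2) *
        inner ℝ (G x) (gradient (fun y : Space N => ψ ‖y‖) x)
          - μ / ‖x‖ ^ p * (|u x| ^ (p - 2) * u x) * ψ ‖x‖
          - lam * (|u x| ^ (p - 2) * u x) * ψ ‖x‖) =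
      ∫ x in ball (0 : Space N) R, K₁ ‖x‖ := by
    refine integral_congr_ae ?_
    filter_upwards [hu, hG, hne, ae_restrict_mem measurableSet_ball] with x hx hGx hx0 hxB
    have hx' : 0 < ‖x‖ := norm_pos_iff.2 hx0
    have hfx : 0 ≤ f ‖x‖ := hf0 _ ⟨hx', by simpa using hxB⟩
    have a1 : ‖G x‖ = |g ‖x‖| := by
      rw [hGx, norm_smul, norm_mul, norm_inv, norm_norm, Real.norm_eq_abs, mul_assoc,
        inv_mul_cancel₀ hx'.ne', mul_one]
    have a2 : inner ℝ (G x) (gradient (fun y : Space N => ψ ‖y‖) x) = g ‖x‖ * deriv ψ ‖x‖ := by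
      rw [real_inner_comm, inner_gradient, (hψ.fderiv_comp_norm x).fderiv, hGx]
      simp only [smul_apply, innerSL_apply_apply, inner_smul_right,
        real_inner_self_eq_norm_sq, smul_eq_mul]
      field_simp
    have a3 : |u x| ^ (p - 2) * u x = f ‖x‖ ^ (p - 1) := by
      rw [hx, ← signedPow_of_nonneg hp' hfx, signedPow]
      ring_nf
    have a4 : μ / ‖x‖ ^ p = μ * ‖x‖ ^ (-p) := by
      rw [Real.rpow_neg hx'.le, div_eq_mul_inv]
    simp only [a1, a2, a3, a4, hK₁, signedPow, show p - 1 - 1 = p - 2 by ring]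
    ring
  have e2 : ∫ x in ball (0 : Space N) R, |u x| ^ (critExp N p - 2) * u x * ψ ‖x‖ =
      ∫ x in ball (0 : Space N) R, K₂ ‖x‖ := by
    refine integral_congr_ae ?_
    filter_upwards [hu, hne, ae_restrict_mem measurableSet_ball] with x hx hx0 hxB
    have hx' : 0 < ‖x‖ := norm_pos_iff.2 hx0
    have hfx : 0 ≤ f ‖x‖ := hf0 _ ⟨hx', by simpa using hxB⟩
    have a3 : |u x| ^ (critExp N p - 2) * u x = f ‖x‖ ^ (critExp N p - 1) := by
      rw [hx, ← signedPow_of_nonneg (by rw [hcrit]; positivity) hfx, signedPow]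
      ring_nf
    rw [a3, hcrit, Real.rpow_add_of_nonneg hfx hp'.le hσ.le]
  rw [e1, e2, integral_ball_radial hN, integral_ball_radial hN] at key
  have key := mul_left_cancel₀ (sphereArea_pos hN).ne' key
  have hr0 : ∀ c : ℝ, ContinuousOn (fun r : ℝ => r ^ c) (Ioo 0 R) := fun c r hr =>
    (Real.continuousAt_rpow_const r c (Or.inl hr.1.ne')).continuousWithinAt
  have hB1 : LocallyIntegrableOn (fun r => r ^ ((N : ℝ) - 1) *
      (f r ^ (p - 1) * (μ * r ^ (-p) + lam))) (Ioo 0 R) := by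
    refine ContinuousOn.locallyIntegrableOn ?_ measurableSet_Ioo
    exact (hr0 _).mul ((hfc.rpow_const fun r hr => Or.inr hp'.le).mul
      (((hr0 _).const_smul μ).add continuousOn_const))
  have hB2 : LocallyIntegrableOn (fun r => r ^ ((N : ℝ) - 1) *
      (f r ^ (p - 1) * f r ^ (p * (p / (N - p))))) (Ioo 0 R) := by
    refine ContinuousOn.locallyIntegrableOn ?_ measurableSet_Ioo
    exact (hr0 _).mul ((hfc.rpow_const fun r hr => Or.inr hp'.le).mul
      (hfc.rpow_const fun r hr => Or.inr hσ.le))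
  have i0 := hψ.isBump_deriv.integrable_mul hA
  have i1 := hψ.integrable_mul hB1
  have i2 := hψ.integrable_mul hB2
  have k1 : ∫ r in Ioo 0 R, r ^ (N - 1) * K₁ r =
      (∫ r, r ^ ((N : ℝ) - 1) * signedPow (p - 1) (g r) * deriv ψ r) -
        ∫ r, r ^ ((N : ℝ) - 1) * (f r ^ (p - 1) * (μ * r ^ (-p) + lam)) * ψ r := by
    rw [← setIntegral_mul_bump hψ.isBump_deriv, ← setIntegral_mul_bump hψ,
      ← integral_sub i0.integrableOn i1.integrableOn]
    refine integral_congr_ae (ae_of_all _ fun r => ?_)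
    simp only [pow_sub_one_eq_rpow hN, hK₁]
    ring
  have k2 : ∫ r in Ioo 0 R, r ^ (N - 1) * K₂ r =
      ∫ r, r ^ ((N : ℝ) - 1) * (f r ^ (p - 1) * f r ^ (p * (p / (N - p)))) * ψ r := by
    rw [← setIntegral_mul_bump hψ]
    refine integral_congr_ae (ae_of_all _ fun r => ?_)
    simp only [pow_sub_one_eq_rpow hN, hK₂]
    ring
  rw [k1, k2, sub_eq_iff_eq_add, ← integral_add i2 i1] at key
  rw [key]
  refine integral_congr_ae (ae_of_all _ fun r => ?_)
  ring

/-- A positive radial weak solution has a classical profile. -/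
theorem IsWeakSolution.exists_profile (hp : 1 < p) (hpN : p < N) (hR : 0 < R)
    {u : Space N → ℝ} (hu : IsWeakSolution p μ lam (ball 0 R) u)
    (hu_pos : IsPositive (ball 0 R) u) (hu_rad : IsRadial (ball 0 R) u) :
    ∃ f q : ℝ → ℝ, (∀ᵐ x ∂(volume.restrict (ball (0 : Space N) R)), u x = f ‖x‖) ∧
      IsNonnegProfile N p μ lam R f q := by
  have hN : 0 < N := by
    have : (0 : ℝ) < N := by linarith
    exact_mod_cast this
  have hp' : 0 < p - 1 := by linarith
  have hNp : 0 < (N : ℝ) - p := by linarith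
  have hσ : 0 < p * (p / (N - p)) := by positivity
  obtain ⟨G, hW, hweak⟩ := hu
  obtain ⟨f₀, hf₀⟩ := hu_rad
  obtain ⟨g, hg0, hg, huf⟩ := hW.exists_primitive_profile hN hR hp.le hf₀
  have hGr := hW.ae_gradient_radial hN hR hp.le hg huf
  set f : ℝ → ℝ := fun r => ∫ s in R..r, g s with hf
  have hgL : LocallyIntegrableOn g (Ioi 0) := by
    have := locallyIntegrableOn_indicator hg
    rwa [indicator_eq_self.2 fun r hr => by_contra fun hc => hr (hg0 r hc)] at this
  have hfc : ContinuousOn f (Ioi 0) := by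
    intro r hr
    have hr' : 0 < r := hr
    have := continuousOn_primitive (a := 0) (b := r + R) (hgL.mono_set Ioo_subset_Ioi_self) (c := R)
      ⟨hR, by linarith⟩
    exact (this.continuousAt (Ioo_mem_nhds hr' (by linarith))).continuousWithinAt
  have hpos : ∀ᵐ r ∂(volume.restrict (Ioo 0 R)), 0 < f r := by
    refine (ae_ball_radial_iff hN).1 ?_
    filter_upwards [hu_pos, huf] with x h1 h2
    rwa [h2] at h1
  -- By continuity the set where f < 0 is open; being null, it is empty.
  have hf0 : ∀ r ∈ Ioo 0 R, 0 ≤ f r := by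
    have ho : IsOpen (Ioo 0 R ∩ f ⁻¹' Iio 0) :=
      (hfc.mono Ioo_subset_Ioi_self).isOpen_inter_preimage isOpen_Ioo isOpen_Iio
    have h0 : volume (Ioo 0 R ∩ f ⁻¹' Iio 0) = 0 := by
      rw [ae_restrict_iff' measurableSet_Ioo] at hpos
      refine measure_mono_null (fun r hr => ?_) hpos
      exact fun hc => absurd (hc hr.1) (not_lt.2 (le_of_lt hr.2))
    have he := ho.measure_eq_zero_iff _ |>.1 h0
    intro r hr
    by_contra! hc
    exact (he ▸ (show r ∈ Ioo 0 R ∩ f ⁻¹' Iio 0 from ⟨hr, hc⟩) : r ∈ (∅ : Set ℝ))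
  have hgm : AEStronglyMeasurable g (volume.restrict (Ioo 0 R)) :=
    (hgL.mono_set Ioo_subset_Ioi_self).aestronglyMeasurable
  have henergy : IntegrableOn (fun r => r ^ ((N : ℝ) - 1) * |g r| ^ p) (Ioo 0 R) := by
    have h1 := hW.2.1.integrable_norm_rpow (by simpa using by linarith) ENNReal.ofReal_ne_top
    rw [ENNReal.toReal_ofReal (by linarith)] at h1
    have h2 : IntegrableOn (fun x : Space N => |g ‖x‖| ^ p) (ball 0 R) := by
      refine h1.congr ?_
      have hnt := nontrivial_space hN
      have hne : ∀ᵐ x ∂(volume.restrict (ball (0 : Space N) R)), x ≠ 0 :=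
        ae_restrict_of_ae (compl_mem_ae_iff.2 (measure_singleton 0))
      filter_upwards [hGr, hne] with x hGx hx0
      have hx' : 0 < ‖x‖ := norm_pos_iff.2 hx0
      rw [hGx, norm_smul, norm_mul, norm_inv, norm_norm, Real.norm_eq_abs, mul_assoc,
        inv_mul_cancel₀ hx'.ne', mul_one]
    simpa only [pow_sub_one_eq_rpow hN] using
      (integrableOn_ball_radial_iff hN (k := fun r => |g r| ^ p)).1 h2
  have hrN : IntegrableOn (fun r : ℝ => r ^ ((N : ℝ) - 1)) (Ioo 0 R) := by
    simp only [← pow_sub_one_eq_rpow hN]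
    exact ((continuous_pow _).continuousOn.integrableOn_compact
      (isCompact_Icc (a := 0) (b := R))).mono_set Ioo_subset_Icc_self
  have hA : LocallyIntegrableOn (fun r => r ^ ((N : ℝ) - 1) * signedPow (p - 1) (g r))
      (Ioo 0 R) := by
    refine IntegrableOn.locallyIntegrableOn (Integrable.mono (hrN.add henergy)
      (hrN.aestronglyMeasurable.mul
        ((continuous_signedPow hp').comp_aestronglyMeasurable hgm)) ?_)
    refine (ae_restrict_iff' measurableSet_Ioo).2 (ae_of_all _ fun r hr => ?_)
    have hr0 : 0 < r := hr.1
    -- This dominates the flux by the finite energy density plus an integrable weight.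
    have h1 : |g r| ^ (p - 1) ≤ 1 + |g r| ^ p := by
      have h0 : 0 ≤ |g r| ^ p := Real.rpow_nonneg (abs_nonneg _) _
      rcases le_total |g r| 1 with h | h
      · linarith [Real.rpow_le_one (abs_nonneg (g r)) h hp'.le]
      · linarith [Real.rpow_le_rpow_of_exponent_le h (by linarith : p - 1 ≤ p)]
    have h2 : 0 < r ^ ((N : ℝ) - 1) := by positivity
    simp only [Pi.add_apply]
    rw [norm_mul, Real.norm_eq_abs (signedPow _ _), abs_signedPow hp', Real.norm_of_nonneg h2.le]
    refine le_trans ?_ (Real.le_norm_self _)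
    calc _ ≤ r ^ ((N : ℝ) - 1) * (1 + |g r| ^ p) := by gcongr
      _ = _ := by ring
  set B : ℝ → ℝ := fun r => r ^ ((N : ℝ) - 1) * (f r ^ (p - 1) *
        (μ * r ^ (-p) + lam + f r ^ (p * (p / (N - p))))) with hB
  have hr0 : ∀ c : ℝ, ContinuousOn (fun r : ℝ => r ^ c) (Ioi 0) := fun c r hr =>
    (Real.continuousAt_rpow_const r c (Or.inl (ne_of_gt hr))).continuousWithinAt
  have hBc : ContinuousOn B (Ioi 0) :=
    (hr0 _).mul ((hfc.rpow_const fun r hr => Or.inr hp'.le).mul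
      ((((hr0 _).const_smul μ).add continuousOn_const).add
        (hfc.rpow_const fun r hr => Or.inr hσ.le)))
  have hmid : R / 2 ∈ Ioo 0 R := ⟨by linarith, by linarith⟩
  have hBL : LocallyIntegrableOn (fun r => -B r) (Ioo 0 R) :=
    (hBc.neg.mono Ioo_subset_Ioi_self).locallyIntegrableOn measurableSet_Ioo
  obtain ⟨C, hC⟩ := ae_eq_primitive_of_weakDeriv hR hA hBL (fun ψ hψ => by
    rw [hψ.weak_radial_equation hN hp hpN hweak huf hGr hf0 (hfc.mono Ioo_subset_Ioi_self) hA]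
    rw [← integral_neg]
    refine integral_congr_ae (ae_of_all _ fun r => ?_)
    simp only [hB]
    ring) hmid
  -- The differentiable representative of -r^(N-1) |g|^(p-2) g, defined on all of (0, ∞) and thus
  -- also at R.
  set q : ℝ → ℝ := fun r => -(C + ∫ s in (R / 2)..r, -B s) with hq
  have hprim : ∀ {k : ℝ → ℝ}, ContinuousOn k (Ioi 0) → ∀ {c r : ℝ}, 0 < c → 0 < r →
      HasDerivAt (fun r => ∫ s in c..r, k s) (k r) r := by
    intro k hk c r hc hr
    have hsub : uIcc c r ⊆ Ioi 0 := fun s hs => (lt_min hc hr).trans_le hs.1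
    exact intervalIntegral.integral_hasDerivAt_right ((hk.mono hsub).intervalIntegrable)
      (hk.stronglyMeasurableAtFilter isOpen_Ioi r hr) (hk.continuousAt (Ioi_mem_nhds hr))
  have hqd : ∀ r, 0 < r → HasDerivAt q (B r) r := fun r hr => by
    have := ((hprim hBc.neg hmid.1 hr).const_add C).neg
    exact this.congr_deriv (by simp)
  have hqc : ContinuousOn q (Ioi 0) := fun r hr => (hqd r hr).continuousAt.continuousWithinAt
  set k : ℝ → ℝ := fun r => -signedPow (1 / (p - 1)) (q r * r ^ (1 - (N : ℝ))) with hk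
  have hkc : ContinuousOn k (Ioi 0) :=
    ((continuous_signedPow (one_div_pos.2 hp')).comp_continuousOn (hqc.mul (hr0 _))).neg
  -- Inverting the odd power shows that g has a continuous representative, so its primitive f is
  -- classically differentiable.
  have hgk : ∀ᵐ r, r ∈ Ioo 0 R → g r = k r := by
    filter_upwards [hC] with r hr hr'
    have h1 := hr hr'
    have h2 : 0 < r ^ ((N : ℝ) - 1) := Real.rpow_pos_of_pos hr'.1 _
    have h3 : r ^ ((N : ℝ) - 1) * r ^ (1 - (N : ℝ)) = 1 := by
      rw [← Real.rpow_add hr'.1]; simp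
    have h4 : signedPow (p - 1) (g r) = -(q r * r ^ (1 - (N : ℝ))) := by
      have h5 : r ^ ((N : ℝ) - 1) * signedPow (p - 1) (g r) = -q r := by
        simp only [hq]; linarith
      calc signedPow (p - 1) (g r) =
          (r ^ ((N : ℝ) - 1) * r ^ (1 - (N : ℝ))) * signedPow (p - 1) (g r) := by rw [h3, one_mul]
        _ = (r ^ ((N : ℝ) - 1) * signedPow (p - 1) (g r)) * r ^ (1 - (N : ℝ)) := by ring
        _ = _ := by rw [h5]; ring
    have h6 := signedPow_signedPow (x := g r) (one_div_pos.2 hp') hp' (mul_one_div_cancel hp'.ne')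
    rw [← h6, h4, signedPow_neg]
  have hfk : ∀ r ∈ Ioo 0 R, f r = ∫ s in R..r, k s := by
    intro r hr
    refine intervalIntegral.integral_congr_ae ?_
    have hneR : ∀ᵐ s : ℝ, s ≠ R := compl_mem_ae_iff.2 (measure_singleton R)
    filter_upwards [hgk, hneR] with s hs hsR hs'
    rw [uIoc_of_ge hr.2.le] at hs'
    exact hs ⟨hr.1.trans hs'.1, lt_of_le_of_ne hs'.2 hsR⟩
  refine ⟨f, q, huf, ?_⟩
  exact
  { f_nonneg := hf0
    f_pos_ae := hpos
    deriv_f := fun r hr => by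
      refine (hprim hkc hR hr.1).congr_of_eventuallyEq ?_
      filter_upwards [isOpen_Ioo.mem_nhds hr] with s hs using hfk s hs
    deriv_q := fun r hr => hqd r hr.1
    f_R := by
      have h1 : f R = 0 := intervalIntegral.integral_same
      have h2 := (hfc.continuousAt (Ioi_mem_nhds hR)).tendsto
      rw [h1] at h2
      exact h2.mono_left nhdsWithin_le_nhds
    q_R := (hqd R hR).continuousAt.tendsto.mono_left nhdsWithin_le_nhds
    energy := by
      refine henergy.congr_fun_ae ?_
      rw [EventuallyEq, ae_restrict_iff' measurableSet_Ioo]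
      filter_upwards [hgk] with r hr hr'
      rw [hr hr', hk, abs_neg] }

end WeakSolution

end HardySobolev

theorem theorem1p1 (N : ℕ) (p μ lam R : ℝ)
    (hp : 1 < p) (hpN : p ^ 2 < N)
    (hμ0 : 0 < μ) (hμ : μ ≤ (N : ℝ) ^ (p - 1) * (N - p ^ 2) / p ^ p)
    (hR : 0 < R)
    (hlam0 : 0 < lam)
    (hlam : lam <
      HardySobolev.firstEigenvalue p μ (Metric.ball (0 : HardySobolev.Space N) R))
    (u v : HardySobolev.Space N → ℝ)
    (hu : HardySobolev.IsWeakSolution p μ lam (Metric.ball 0 R) u)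
    (hu_pos : HardySobolev.IsPositive (Metric.ball 0 R) u)
    (hu_rad : HardySobolev.IsRadial (Metric.ball 0 R) u)
    (hv : HardySobolev.IsWeakSolution p μ lam (Metric.ball 0 R) v)
    (hv_pos : HardySobolev.IsPositive (Metric.ball 0 R) v)
    (hv_rad : HardySobolev.IsRadial (Metric.ball 0 R) v) :
    ∀ᵐ x ∂(MeasureTheory.volume.restrict (Metric.ball (0 : HardySobolev.Space N) R)),
      u x = v x := by
  have hpN' : p < N := by nlinarith
  have hN : 0 < N := by
    have : (0 : ℝ) < N := by linarith
    exact_mod_cast this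
  obtain ⟨f₁, q₁, hf₁, h₁⟩ := hu.exists_profile hp hpN' hR hu_pos hu_rad
  obtain ⟨f₂, q₂, hf₂, h₂⟩ := hv.exists_profile hp hpN' hR hv_pos hv_rad
  have heq := (h₁.isPositiveProfile hp hpN' hlam0 hμ0).eqOn hp hpN' hlam0 hμ0 hR
    (h₂.isPositiveProfile hp hpN' hlam0 hμ0)
  have hae : ∀ᵐ r ∂(MeasureTheory.volume.restrict (Set.Ioo 0 R)), f₁ r = f₂ r :=
    (MeasureTheory.ae_restrict_iff' measurableSet_Ioo).2 (Filter.Eventually.of_forall heq)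
  filter_upwards [hf₁, hf₂, (HardySobolev.ae_ball_radial_iff hN).2 hae] with x h1 h2 h3
  rw [h1, h2, h3]
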